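/- Let $p$ be an odd prime, let $\mathbb{K}$ be an imaginary quadratic field with ring of integers $\mathcal{O}$, and suppose that $p$ splits in $\mathcal{O}$, i.e. $p\mathcal{O}=\mathfrak{p}_1\mathfrak{p}_2$ with primes $\mathfrak{p}_1\neq\mathfrak{p}_2$. Put $R=\mathcal{O}/p\mathcal{O}$ and $R_i=\mathcal{O}/\mathfrak{p}_i$, so that $R\cong R_1\oplus R_2$. For an $\mathcal{O}$-module $M$ of exponent $p$, the $R$-rank of $M$ is the pair $$\mathrm{rk}_R M:=\bigl(\mathrm{rk}_{R_1}(M\otimes_R R_1),\ \mathrm{rk}_{R_2}(M\otimes_R R_2)\bigr).$$ Let $L/K$ be a cyclic extension of number fields of $p$-power degree, and let $E$ be an elliptic curve over $K$ with complex multiplication by $\mathcal{O}$ defined over $K$, i.e. with an embedding of rings $\mathcal{O}\subset\mathrm{End}_K(E)$. Let $v$ be a (finite) prime of $K$ and $w$ a prime of $L$ above $v$, and let $K_v\subset L_w$ be the completions. If $L_w\neq K_v$, let $L'_w$ be the extension of $K_v$ inside $L_w$ with $[L_w:L'_w]=p$; otherwise let $L'_w=L_w=K_v$. Let $N_{L_w/L'_w}:E(L_w)\to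 E(L'_w)$ be the norm map $Q\mapsto\sum_{\sigma\in\mathrm{Gal}(L_w/L'_w)}\sigma(Q)$. The arithmetic local constant $\delta_v=\delta(v,E,L/K)\in(\mathbb{Z}/2\mathbb{Z})^2$ is defined by $$\delta_v\equiv\mathrm{rk}_R\, E(K_v)/\bigl(E(K_v)\cap N_{L_w/L'_w}E(L_w)\bigr)\pmod 2 .$$ **Proposition.** Suppose that $v\nmid p$, that $E$ has good reduction at $v$, and that $L_w/K_v$ is nontrivial and totally ramified. Then $$\delta_v\equiv\mathrm{rk}_R\,E(K_v)[p]\pmod 2$$ (a congruence in both components). -/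

import Mathlib

open scoped NumberField TensorProduct WeierstrassCurve.Affine
open IsDedekindDomain

universe u

noncomputable section

namespace EllCM

/-! ### Points of an elliptic curve over extensions of its field of definition -/

section Points

variable {K : Type u} [Field K]

/-- The group `E(F)` of `F`-rational points, for a field extension `F` of the field of definition
`K` of `E`. -/
def Points (E : WeierstrassCurve K) (F : Type u) [Field F] [Algebra K F] : Type u :=
  WeierstrassCurve.Affine.Point (E.baseChange F)

variable (E : WeierstrassCurve K)

open Classical in
instance (F : Type u) [Field F] [Algebra K F] : AddCommGroup (Points E F) :=
  inferInstanceAs (AddCommGroup (WeierstrassCurve.Affine.Point (E.baseChange F)))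

open Classical in
/-- The homomorphism `E(F) → E(F')` induced by a `K`-embedding `F → F'`. -/
def Points.map {F F' : Type u} [Field F] [Algebra K F] [Field F'] [Algebra K F']
    (g : F →ₐ[K] F') : Points E F →+ Points E F' :=
  WeierstrassCurve.Affine.Point.map (W' := E) g

variable {E} in
/-- A vector of homogeneous coordinates in `ℙ²(F)` of a point of `E(F)`: `[0 : 1 : 0]` for the
origin and `[x : y : 1]` for an affine point `(x, y)`. -/
def Points.coords {F : Type u} [Field F] [Algebra K F] : Points E F → Fin 3 → F
  | WeierstrassCurve.Affine.Point.zero => ![0, 1, 0]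
  | WeierstrassCurve.Affine.Point.some x y _ => ![x, y, 1]

/-- A family of maps `φ_F : E(F) → E(F)`, for all field extensions `F` of `K`, is a morphism of
`K`-varieties `E → E` if around every point `P` it is given by a triple of homogeneous polynomials
of the same degree with coefficients in `K`: the triple `f = (f₀, f₁, f₂)` does not vanish
at `P`, and wherever `f` does not vanish, it is a vector of homogeneous coordinates of the image
under `φ` (the scalar `c` is zero exactly where `f` vanishes). -/
def IsMorphism (φ : ∀ (F : Type u) [Field F] [Algebra K F], Points E F → Points E F) : Prop :=
  ∀ (F : Type u) [Field F] [Algebra K F] (P : Points E F),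
    ∃ (d : ℕ) (f : Fin 3 → MvPolynomial (Fin 3) K),
      (∀ i, (f i).IsHomogeneous d) ∧
      (∃ i, MvPolynomial.aeval P.coords (f i) ≠ 0) ∧
      ∀ (F' : Type u) [Field F'] [Algebra K F'] (Q : Points E F'),
        ∃ c : F', ∀ i, MvPolynomial.aeval Q.coords (f i) = c * (φ F' Q).coords i

/-- An element of `End_K(E)`: a morphism of `K`-varieties `E → E` which is a homomorphism for the
group law. -/
structure Endo : Type (u + 1) where
  /-- The action of the endomorphism on `E(F)`. -/
  app : ∀ (F : Type u) [Field F] [Algebra K F], Points E F →+ Points E F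
  natural : ∀ (F F' : Type u) [Field F] [Algebra K F] [Field F'] [Algebra K F']
    (g : F →ₐ[K] F') (P : Points E F), Points.map E g (app F P) = app F' (Points.map E g P)
  isMorphism : IsMorphism E (fun F _ _ P => app F P)

/-- An embedding of the ring `O` into the endomorphism ring `End_K(E)`, whose addition is pointwise
and whose multiplication is composition. -/
structure CMEmbedding (O : Type*) [CommRing O] where
  /-- The underlying map `O → End_K(E)`. -/
  toEndo : O → Endo E
  injective : Function.Injective toEndo
  map_one : ∀ (F : Type u) [Field F] [Algebra K F] (P : Points E F), (toEndo 1).app F P = P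
  map_mul : ∀ (a b : O) (F : Type u) [Field F] [Algebra K F] (P : Points E F),
    (toEndo (a * b)).app F P = (toEndo a).app F ((toEndo b).app F P)
  map_add : ∀ (a b : O) (F : Type u) [Field F] [Algebra K F] (P : Points E F),
    (toEndo (a + b)).app F P = (toEndo a).app F P + (toEndo b).app F P

variable {E} {O : Type*} [CommRing O] (ι : CMEmbedding E O)

/-- The group `E(F)` regarded as an `O`-module through `ι : O → End_K(E)`. -/
def CMEmbedding.Module (_ι : CMEmbedding E O) (F : Type u) [Field F] [Algebra K F] : Type u :=
  Points E F

instance (F : Type u) [Field F] [Algebra K F] : AddCommGroup (ι.Module F) :=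
  inferInstanceAs (AddCommGroup (Points E F))

instance (F : Type u) [Field F] [Algebra K F] : _root_.Module O (ι.Module F) where
  smul a P := (ι.toEndo a).app F P
  one_smul P := ι.map_one F P
  mul_smul a b P := ι.map_mul a b F P
  smul_zero a := map_zero ((ι.toEndo a).app F)
  smul_add a P Q := map_add ((ι.toEndo a).app F) P Q
  add_smul a b P := ι.map_add a b F P
  zero_smul P := by
    have h := ι.map_add 0 0 F P
    rw [add_zero] at h
    exact left_eq_add.mp h

end Points

/-! ### The rank over `R = O / pO ≅ O / 𝔭₁ × O / 𝔭₂` -/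

/-- The `R`-rank of an `O`-module `M` of exponent `p`, where `pO = 𝔭₁𝔭₂`, `R = O / pO` and
`R_i = O / 𝔭_i`: the pair of the ranks of `R_i ⊗ M` over `R_i`. The tensor product over `O` agrees
with that over `R`, since `R` is a quotient ring of `O` and `M` is killed by `pO`. -/
def rankPair {O : Type*} [CommRing O] (𝔭₁ 𝔭₂ : Ideal O) (M : Type*) [AddCommGroup M] [Module O M] :
    ℕ × ℕ :=
  (Module.finrank (O ⧸ 𝔭₁) ((O ⧸ 𝔭₁) ⊗[O] M), Module.finrank (O ⧸ 𝔭₂) ((O ⧸ 𝔭₂) ⊗[O] M))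

/-- A pair of natural numbers modulo `2`. -/
def modTwo (r : ℕ × ℕ) : ZMod 2 × ZMod 2 := (r.1, r.2)

/-! ### The norm map and the local constant -/

section Norm

variable {K : Type u} [Field K] (E : WeierstrassCurve K)
  (F M : Type u) [Field F] [Field M] [Algebra K F] [Algebra K M] [Algebra F M] [IsScalarTower K F M]

/-- For a finite Galois extension `M / L'` (with `K ⊆ F ⊆ L' ⊆ M`), the norm
`N_{M / L'} = ∑ σ`, sum over `σ ∈ Gal(M / L')`, regarded as a map `E(M) → E(L') ⊆ E(M)`. -/
def norm (L' : IntermediateField F M) : Points E M →+ Points E M :=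
  ∑ᶠ σ : M ≃ₐ[L'] M, Points.map E ((σ.restrictScalars F).restrictScalars K : M ≃ₐ[K] M).toAlgHom

/-- The inclusion `E(F) ⊆ E(M)`. -/
def incl : Points E F →+ Points E M := Points.map E (IsScalarTower.toAlgHom K F M)

variable {E} {O : Type*} [CommRing O] (ι : CMEmbedding E O)

lemma norm_app (L' : IntermediateField F M) (a : O) (Q : Points E M) :
    norm E F M L' ((ι.toEndo a).app M Q) = (ι.toEndo a).app M (norm E F M L' Q) := by
  revert Q
  refine finsum_induction (fun φ : Points E M →+ Points E M =>
    ∀ Q, φ ((ι.toEndo a).app M Q) = (ι.toEndo a).app M (φ Q)) ?_ ?_ ?_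
  · intro Q
    simp
  · intro φ ψ hφ hψ Q
    simp [hφ, hψ]
  · intro σ Q
    exact (ι.toEndo a).natural M M _ Q

/-- The `O`-submodule `E(F) ∩ N_{M / L'} E(M)` of `E(F)`. -/
def normSubmodule (L' : IntermediateField F M) : Submodule O (ι.Module F) where
  carrier := {P | ∃ Q : Points E M, incl E F M P = norm E F M L' Q}
  zero_mem' := ⟨0, by rw [map_zero]; exact map_zero _⟩
  add_mem' := by
    rintro P₁ P₂ ⟨Q₁, h₁⟩ ⟨Q₂, h₂⟩
    exact ⟨Q₁ + Q₂, by rw [map_add, ← h₁, ← h₂]; exact map_add _ _ _⟩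
  smul_mem' := by
    rintro a P ⟨Q, h⟩
    refine ⟨(ι.toEndo a).app M Q, ?_⟩
    rw [norm_app, ← h]
    exact (ι.toEndo a).natural F M _ P

/-- The condition defining the subfield `L'` of the cyclic `p`-power extension `M / F`:
`[M : L'] = p` if `M ≠ F`, and `L' = M = F` otherwise. -/
def IsIndexP (p : ℕ) (L' : IntermediateField F M) : Prop :=
  ((⊥ : IntermediateField F M) ≠ ⊤ → Module.finrank L' M = p) ∧
    ((⊥ : IntermediateField F M) = ⊤ → L' = ⊤)

/-- The arithmetic local constant for the extension `M / F` of local fields (`F = K_v`, `M = L_w`,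
`L' = L'_w`): the class modulo `2` of the `R`-rank of `E(F) / (E(F) ∩ N_{M / L'} E(M))`. -/
def localConstant (𝔭₁ 𝔭₂ : Ideal O) (L' : IntermediateField F M) : ZMod 2 × ZMod 2 :=
  modTwo (rankPair 𝔭₁ 𝔭₂ (ι.Module F ⧸ normSubmodule F M ι L'))

end Norm

/-! ### Completions of number fields -/

section Completion

variable {K L : Type u} [Field K] [NumberField K] [Field L] [NumberField L] [Algebra K L]
  (v : HeightOneSpectrum (𝓞 K)) (w : HeightOneSpectrum (𝓞 L))

/-- The embedding `K_v → L_w` for a prime `w` of `L` above `v`: the continuous extension of the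
inclusion `K ⊆ L`. -/
def completionMap [w.asIdeal.LiesOver v.asIdeal] : v.adicCompletion K →+* w.adicCompletion L :=
  ((HeightOneSpectrum.adicCompletion.equiv L w).symm.toRingHom.comp
    (UniformSpace.Completion.mapRingHom
      (algebraMap (WithVal (v.valuation K)) (WithVal (w.valuation L)))
      (HeightOneSpectrum.uniformContinuous_algebraMap_liesOver K L v w).continuous)).comp
    (HeightOneSpectrum.adicCompletion.equiv K v).toRingHom

variable [w.asIdeal.LiesOver v.asIdeal]

instance : Algebra (v.adicCompletion K) (w.adicCompletion L) := (completionMap v w).toAlgebra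

instance : IsScalarTower K (v.adicCompletion K) (w.adicCompletion L) :=
  .of_algebraMap_eq fun x => by
    apply HeightOneSpectrum.adicCompletion.ext
    exact (UniformSpace.Completion.mapRingHom_coe
      (HeightOneSpectrum.uniformContinuous_algebraMap_liesOver K L v w).continuous
      (algebraMap K (WithVal (v.valuation K)) x)).symm

/-- `L_w / K_v` is totally ramified: the extension of residue fields is trivial, i.e. every integer
of `L_w` is congruent to an integer of `K_v` modulo the maximal ideal. -/
def IsTotallyRamified : Prop :=
  ∀ x : w.adicCompletion L, Valued.v x ≤ 1 →
    ∃ y : v.adicCompletion K, Valued.v y ≤ 1 ∧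
      Valued.v (x - algebraMap (v.adicCompletion K) (w.adicCompletion L) y) < 1

/-- `E` has good reduction at `v`: some Weierstrass equation for `E` over `K_v` is integral with
discriminant a unit. -/
def HasGoodReductionAt (E : WeierstrassCurve K) : Prop :=
  ∃ C : WeierstrassCurve.VariableChange (v.adicCompletion K),
    (C • E.baseChange (v.adicCompletion K)).HasGoodReduction (v.adicCompletionIntegers K)

end Completion

end EllCM

end

/-! Write A = E(K_v) and B = E(L_w), let A₁ and B₁ be the kernels of reduction for a good model, and
let N be the norm from L_w to L'_w. The heart of the proof is A ∩ N(B) = pA. After that the ranks of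
A/pA and A[p] agree exactly, not only modulo 2.

Three facts give A ∩ N(B) = pA. (1) A₁ and B₁ have finite index, since the residue fields are
finite, and p is invertible on them, since v does not divide p (`kerReduction_bijective`).
Multiplication by the residue characteristic n contracts the filtration of the kernel by z = x/y,
and a relation 1 = ap + bn turns this into a convergent series inverting p. Explicit valuation
estimates on collinear points play the role of the formal group. (2) B = A + B₁
(`exists_sub_incl_mem_goodKernel`): total ramification makes the residue fields equal, and Hensel's
lemma lifts points of the reduction to K_v. (3) N is multiplication by p = [L_w : L'_w] on A
(`norm_incl`). If b = r + s with r in A and s in B₁, then N(b) = pr + N(s). Since s is divisible by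
every power of p, N(s) has no p-primary torsion part to contribute, so when it lies in A it lies in
pA (`exists_eq_map_iff_exists_nsmul`).

For the ranks, A is the direct sum of a finite A[p^k] and p^k A. For a finite module T with nonzero
annihilator over a Dedekind domain, T/𝔭T and T[𝔭] have the same order (`card_quotient_smul_top`).
Applied to A[p^k] and to A[p], which have the same 𝔭-torsion, this compares A/pA with A[p]
(`finrank_tensor_quotient_eq`). -/

noncomputable section

namespace EllCM

/-! ### Valuation estimates on Weierstrass equations -/

section ValuationLemmas

variable {F : Type*} [Field F] {Γ₀ : Type*} [LinearOrderedCommGroupWithZero Γ₀] {v : Valuation F Γ₀}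

lemma vle_one : v 1 ≤ 1 := v.map_one.le

lemma vle_add {x y : F} (hx : v x ≤ 1) (hy : v y ≤ 1) : v (x + y) ≤ 1 := v.map_add_le hx hy

lemma vle_sub {x y : F} (hx : v x ≤ 1) (hy : v y ≤ 1) : v (x - y) ≤ 1 := v.map_sub_le hx hy

lemma vle_neg {x : F} (hx : v x ≤ 1) : v (-x) ≤ 1 := by rwa [v.map_neg]

lemma vle_mul {x y : F} (hx : v x ≤ 1) (hy : v y ≤ 1) : v (x * y) ≤ 1 := by
  rw [map_mul]; exact mul_le_one' hx hy

lemma vle_pow {x : F} (n : ℕ) (hx : v x ≤ 1) : v (x ^ n) ≤ 1 := by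
  rw [map_pow]; exact pow_le_one' hx n

lemma vle_natCast (n : ℕ) : v (n : F) ≤ 1 := by
  induction n with
  | zero => simp
  | succ k ih => push_cast; exact vle_add ih vle_one

lemma vle_ofNat (n : ℕ) [n.AtLeastTwo] : v (OfNat.ofNat n : F) ≤ 1 := by
  simpa using! vle_natCast (v := v) (OfNat.ofNat n)

lemma vlt_mul {x y : F} (hx : v x < 1) (hy : v y ≤ 1) : v (x * y) < 1 := by
  rw [map_mul]
  exact (mul_le_of_le_one_right' hy).trans_lt hx

lemma vmul_le {x y : F} {γ δ : Γ₀} (hx : v x ≤ γ) (hy : v y ≤ δ) : v (x * y) ≤ γ * δ := by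
  rw [map_mul]; exact mul_le_mul' hx hy

lemma vmul_le_left {x y : F} {γ : Γ₀} (hx : v x ≤ γ) (hy : v y ≤ 1) : v (x * y) ≤ γ := by
  simpa using vmul_le hx hy

lemma vunit_one_add {x : F} (hx : v x < 1) : v (1 + x) = 1 := v.map_one_add_of_lt hx

end ValuationLemmas

/-! ### Chords and tangents: valuations of three collinear points. -/

section Estimates

variable {F : Type*} [Field F] {Γ₀ : Type*} [LinearOrderedCommGroupWithZero Γ₀]

/-- The coefficients of a Weierstrass equation are integral for a valuation. -/
structure IntegralCoeffs (v : Valuation F Γ₀) (W : WeierstrassCurve F) : Prop where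
  a₁ : v W.a₁ ≤ 1
  a₂ : v W.a₂ ≤ 1
  a₃ : v W.a₃ ≤ 1
  a₄ : v W.a₄ ≤ 1
  a₆ : v W.a₆ ≤ 1

/-- The line `Y = ℓX + m` meets the Weierstrass curve in the three affine points `(xᵢ, yᵢ)`, counted
with multiplicity. -/
structure IsLine (W : WeierstrassCurve F) (ℓ m x₁ y₁ x₂ y₂ x₃ y₃ : F) : Prop where
  y₁ : y₁ = ℓ * x₁ + m
  y₂ : y₂ = ℓ * x₂ + m
  y₃ : y₃ = ℓ * x₃ + m
  e₁ : x₁ + x₂ + x₃ = ℓ ^ 2 + W.a₁ * ℓ - W.a₂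
  e₂ : x₁ * x₂ + x₁ * x₃ + x₂ * x₃ = W.a₄ - 2 * ℓ * m - W.a₁ * m - W.a₃ * ℓ
  e₃ : x₁ * x₂ * x₃ = m ^ 2 + W.a₃ * m - W.a₆

-- The relations come from comparing coefficients in the factorization of `addPolynomial` as a cubic
-- with roots x₁, x₂, x₃. With multiplicities built in, the later estimates become polynomial
-- identities that treat chords and tangents alike.
open WeierstrassCurve.Affine in
lemma exists_isLine [DecidableEq F] {W : WeierstrassCurve F} {x₁ y₁ x₂ y₂ : F}
    (h₁ : W.toAffine.Nonsingular x₁ y₁) (h₂ : W.toAffine.Nonsingular x₂ y₂)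
    (h : ¬(x₁ = x₂ ∧ y₁ = W.toAffine.negY x₂ y₂)) :
    ∃ ℓ m x₃ y₃, ∃ h₃ : W.toAffine.Nonsingular x₃ y₃,
      Point.some x₁ y₁ h₁ + Point.some x₂ y₂ h₂ = -Point.some x₃ y₃ h₃ ∧
      IsLine W ℓ m x₁ y₁ x₂ y₂ x₃ y₃ := by
  set ℓ := W.toAffine.slope x₁ x₂ y₁ y₂ with hℓ
  refine ⟨ℓ, y₁ - ℓ * x₁, W.toAffine.addX x₁ x₂ ℓ, W.toAffine.negAddY x₁ x₂ y₁ ℓ,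
    nonsingular_negAdd h₁ h₂ h, ?_, ?_⟩
  · rw [Point.add_some h]
    rfl
  · have hp := addPolynomial_slope h₁.1 h₂.1 h
    rw [addPolynomial_eq, neg_inj, Cubic.prod_X_sub_C_eq, Cubic.toPoly_injective] at hp
    rw [← hℓ] at hp
    have hb := congrArg Cubic.b hp
    have hc := congrArg Cubic.c hp
    have hd := congrArg Cubic.d hp
    simp only at hb hc hd
    refine ⟨by ring, ?_, by simp only [negAddY]; ring, by linear_combination hb,
      by linear_combination -hc, by linear_combination hd⟩
    by_cases hx : x₁ = x₂
    · rcases Y_eq_of_X_eq h₁.1 h₂.1 hx with hy | hy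
      · rw [hx, hy]; ring
      · exact absurd ⟨hx, hy⟩ h
    · rw [hℓ, slope_of_X_ne hx]
      field_simp [sub_ne_zero.mpr hx]
      ring

variable {v : Valuation F Γ₀} {W : WeierstrassCurve F}

/-- The valuations of the coordinates of a point in the kernel of reduction. -/
structure IsKer (v : Valuation F Γ₀) (x y : F) : Prop where
  x_ne : x ≠ 0
  y_ne : y ≠ 0
  z_lt : v (x / y) < 1
  vx : v x = (v (x / y) ^ 2)⁻¹
  vy : v y = (v (x / y) ^ 3)⁻¹

/-- Once x is not integral, x³ dominates the right side of the Weierstrass equation. This forces v x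
< v y, so y² dominates the left side and v(y)² = v(x)³. Both valuations are then powers of v(x/y).
-/
lemma isKer_of_one_lt (hW : IntegralCoeffs v W) {x y : F} (h : W.toAffine.Equation x y)
    (hx : 1 < v x) : IsKer v x y := by
  obtain ⟨h1, h2, h3, h4, h6⟩ := hW
  rw [WeierstrassCurve.Affine.equation_iff] at h
  have hx0 : x ≠ 0 := by
    rintro rfl
    simp at hx
  have hvx0 : v x ≠ 0 := v.ne_zero_iff.mpr hx0
  have hu : v x⁻¹ < 1 := by
    rw [map_inv₀]
    exact inv_lt_one_of_one_lt₀ hx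
  have hu' := hu.le
  have hr : v (y ^ 2 + W.a₁ * x * y + W.a₃ * y) = v x ^ 3 := by
    have : y ^ 2 + W.a₁ * x * y + W.a₃ * y =
        x ^ 3 * (1 + x⁻¹ * (W.a₂ + W.a₄ * x⁻¹ + W.a₆ * x⁻¹ ^ 2)) := by
      rw [h]; field_simp; ring
    rw [this, map_mul, map_pow, vunit_one_add (vlt_mul hu
      (by apply_rules [vle_add, vle_mul, vle_pow])), mul_one]
  have hxy : v x < v y := by
    by_contra! hle
    have hs : v (y / x) ≤ 1 := by
      rw [map_div₀]
      exact div_le_one_of_le₀ hle zero_le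
    have h5 : y ^ 2 + W.a₁ * x * y + W.a₃ * y =
        x ^ 2 * ((y / x) ^ 2 + W.a₁ * (y / x) + W.a₃ * (y / x) * x⁻¹) := by
      field_simp
    have h6 : v x ^ 3 ≤ v x ^ 2 := by
      rw [← hr, h5, ← map_pow]
      exact vmul_le_left le_rfl (by apply_rules [vle_add, vle_mul, vle_pow])
    exact absurd h6 (not_le.mpr (pow_lt_pow_right₀ hx (by norm_num)))
  have hvy0 : v y ≠ 0 := (zero_le.trans_lt hxy).ne'
  have hy0 : y ≠ 0 := v.ne_zero_iff.mp hvy0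
  have hz : v (x / y) < 1 := by
    rw [map_div₀]
    exact (div_lt_one₀ (zero_lt_iff.mpr hvy0)).mpr hxy
  have hz' := hz.le
  have hl : v y ^ 2 = v x ^ 3 := by
    have : y ^ 2 + W.a₁ * x * y + W.a₃ * y = y ^ 2 * (1 + (x / y) * (W.a₁ + W.a₃ * x⁻¹)) := by
      field_simp; ring
    rw [← hr, this, map_mul, map_pow, vunit_one_add (vlt_mul hz
      (by apply_rules [vle_add, vle_mul, vle_pow])), mul_one]
  refine ⟨hx0, hy0, hz, ?_, ?_⟩
  · rw [map_div₀, div_pow, hl, inv_div, pow_succ, mul_div_cancel_left₀ _ (pow_ne_zero _ hvx0)]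
  · rw [map_div₀, div_pow, ← hl, inv_div, pow_succ (v y),
      mul_div_cancel_left₀ _ (pow_ne_zero _ hvy0)]

lemma IsKer.one_lt {x y : F} (h : IsKer v x y) : 1 < v x := by
  rw [h.vx]
  have h0 : v (x / y) ≠ 0 := v.ne_zero_iff.mpr (div_ne_zero h.x_ne h.y_ne)
  exact (one_lt_inv₀ (zero_lt_iff.mpr (pow_ne_zero _ h0))).mpr
    (pow_lt_one₀ zero_le h.z_lt (by norm_num))

/-- For points in the kernel of reduction on a line, the valuation of `z = x / y` at the third point
is that of the difference of `z` at the first and at the negative of the second. -/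
lemma IsLine.ker (hW : IntegralCoeffs v W) {ℓ m x₁ y₁ x₂ y₂ x₃ y₃ : F}
    (hl : IsLine W ℓ m x₁ y₁ x₂ y₂ x₃ y₃) (h₁ : IsKer v x₁ y₁) (h₂ : IsKer v x₂ y₂)
    (e₃ : W.toAffine.Equation x₃ y₃) :
    IsKer v x₃ y₃ ∧ m ≠ 0 ∧ v m = (v (x₁ / y₁) * v (x₂ / y₂) * v (x₃ / y₃))⁻¹ ∧
      v (x₃ / y₃) = v (x₁ / y₁ + x₂ / y₂ + W.a₁ * (x₁ / y₁) * (x₂ / y₂) +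
        W.a₃ * (x₁ / y₁) * y₂⁻¹) := by
  have hW' := hW
  obtain ⟨h1, h2, h3, h4, h6⟩ := hW
  have hx₁ := h₁.x_ne
  have hx₂ := h₂.x_ne
  have hy₁ := h₁.y_ne
  have hy₂ := h₂.y_ne
  set g₁ := v (x₁ / y₁) with hg₁
  set g₂ := v (x₂ / y₂) with hg₂
  have hg₁0 : g₁ ≠ 0 := v.ne_zero_iff.mpr (div_ne_zero hx₁ hy₁)
  have hg₂0 : g₂ ≠ 0 := v.ne_zero_iff.mpr (div_ne_zero hx₂ hy₂)
  have hz₁ : v (x₁ / y₁) ≤ 1 := h₁.z_lt.le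
  have hz₂ : v (x₂ / y₂) ≤ 1 := h₂.z_lt.le
  have hu₁ : v x₁⁻¹ ≤ 1 := by
    rw [map_inv₀]; exact inv_le_one_of_one_le₀ h₁.one_lt.le
  have hu₂ : v x₂⁻¹ < 1 := by
    rw [map_inv₀]; exact inv_lt_one_of_one_lt₀ h₂.one_lt
  have hw₂ : v y₂⁻¹ ≤ 1 := by
    rw [map_inv₀, h₂.vy, inv_inv]; exact pow_le_one' hz₂ 3
  have hy₁u : v (y₁ * x₁⁻¹ ^ 2) ≤ 1 := by
    rw [map_mul, map_pow, map_inv₀, h₁.vx, h₁.vy, inv_inv, ← hg₁]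
    have : (g₁ ^ 3)⁻¹ * (g₁ ^ 2) ^ 2 = g₁ := by field_simp
    rw [this]; exact hz₁
  set σ := x₁ / y₁ + x₂ / y₂ + W.a₁ * (x₁ / y₁) * (x₂ / y₂) + W.a₃ * (x₁ / y₁) * y₂⁻¹ with hσ
  have hσlt : v σ < 1 := by
    have h0 : σ = (x₁ / y₁) * (1 + W.a₁ * (x₂ / y₂) + W.a₃ * y₂⁻¹) + x₂ / y₂ := by
      rw [hσ]; ring
    rw [h0]
    exact v.map_add_lt (vlt_mul h₁.z_lt (by apply_rules [vle_add, vle_mul, vle_one])) h₂.z_lt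
  -- Here σ y₁ y₂ is the cross product x₂ y₁ - x₁ y(-P₂). Eliminating a₄ and a₆ through the line
  -- relations leaves a polynomial identity, valid also for tangents; the last factor is a unit, so
  -- it determines v(m).
  have hmS : m * (σ * (y₁ * y₂)) = -(x₁ * x₂) ^ 2 * (1 + x₂⁻¹ *
      (-W.a₄ * x₁⁻¹ - W.a₆ * x₁⁻¹ * (x₁⁻¹ + x₂⁻¹) + W.a₃ * (y₁ * x₁⁻¹ ^ 2))) := by
    have hS : σ * (y₁ * y₂) = x₁ * y₂ + x₂ * y₁ + W.a₁ * x₁ * x₂ + W.a₃ * x₁ := by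
      rw [hσ]; field_simp
    have hR : -(x₁ * x₂) ^ 2 * (1 + x₂⁻¹ *
      (-W.a₄ * x₁⁻¹ - W.a₆ * x₁⁻¹ * (x₁⁻¹ + x₂⁻¹) + W.a₃ * (y₁ * x₁⁻¹ ^ 2))) =
        -(x₁ * x₂) ^ 2 + W.a₄ * (x₁ * x₂) + W.a₆ * (x₁ + x₂) - W.a₃ * x₂ * y₁ := by
      field_simp; ring
    rw [hS, hR]
    have ha2 : W.a₂ = ℓ ^ 2 + W.a₁ * ℓ - (x₁ + x₂ + x₃) := by linear_combination hl.e₁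
    have ha4 : W.a₄ = x₁ * x₂ + x₁ * x₃ + x₂ * x₃ + 2 * ℓ * m + W.a₁ * m + W.a₃ * ℓ := by
      linear_combination -hl.e₂
    have ha6 : W.a₆ = m ^ 2 + W.a₃ * m - x₁ * x₂ * x₃ := by linear_combination hl.e₃
    rw [ha4, ha6, hl.y₁, hl.y₂]
    ring
  have hvm : v m * v σ * (g₁ * g₂) = 1 := by
    have h5 := congrArg v hmS
    rw [map_mul, map_mul, map_mul, map_mul, v.map_neg, map_pow, map_mul,
      vunit_one_add (vlt_mul hu₂ (by apply_rules [vle_add, vle_sub, vle_mul, vle_neg, hu₂.le])),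
      mul_one, h₁.vx, h₂.vx, h₁.vy, h₂.vy, ← hg₁, ← hg₂] at h5
    field_simp at h5
    rwa [← mul_assoc]
  have hvm0 : v m ≠ 0 := by
    rintro h0
    simp [h0] at hvm
  have hm0 : m ≠ 0 := v.ne_zero_iff.mp hvm0
  set s := v σ with hs
  have hs0 : s ≠ 0 := by
    rintro h0
    simp [h0] at hvm
  have hvm' : v m = (g₁ * g₂ * s)⁻¹ := by
    refine eq_inv_of_mul_eq_one_left ?_
    rw [← hvm]; ac_rfl
  have hmi : v m⁻¹ < 1 := by
    rw [map_inv₀, hvm', inv_inv]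
    exact (mul_le_of_le_one_left' (mul_le_one' hz₁ hz₂)).trans_lt hσlt
  have hmi' := hmi.le
  have hx₃ : v x₃ = (s ^ 2)⁻¹ := by
    have h5 : x₁ * x₂ * x₃ = m ^ 2 * (1 + m⁻¹ * (W.a₃ - W.a₆ * m⁻¹)) := by
      rw [hl.e₃]; field_simp; ring
    have h5 := congrArg v h5
    rw [map_mul, map_mul, map_mul, map_pow,
      vunit_one_add (vlt_mul hmi (by apply_rules [vle_sub, vle_mul])), hvm', mul_one, h₁.vx, h₂.vx,
      ← hg₁, ← hg₂] at h5
    field_simp at h5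
    exact eq_inv_of_mul_eq_one_left h5
  have hx₃1 : 1 < v x₃ := by
    rw [hx₃]
    exact (one_lt_inv₀ (zero_lt_iff.mpr (pow_ne_zero _ hs0))).mpr (pow_lt_one₀ zero_le hσlt (by norm_num))
  have h₃ := isKer_of_one_lt hW' e₃ hx₃1
  have hg₃ : v (x₃ / y₃) = s := by
    have h5 := h₃.vx
    rw [hx₃, inv_inj] at h5
    exact ((pow_left_inj₀ zero_le zero_le (by norm_num)).mp h5).symm
  exact ⟨h₃, hm0, by rw [hg₃]; exact hvm', hg₃⟩

/-- This replaces the statement that a formal group law is addition up to terms of degree two. In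
the coordinates z = x/y, w = 1/y the line is w = -(ℓ/m) z + 1/m, and both its slope and its
intercept are of size at most γ². -/
lemma IsLine.val_z_add_le (hW : IntegralCoeffs v W) {ℓ m x₁ y₁ x₂ y₂ x₃ y₃ : F}
    (hl : IsLine W ℓ m x₁ y₁ x₂ y₂ x₃ y₃) (h₁ : IsKer v x₁ y₁) (h₂ : IsKer v x₂ y₂)
    (e₃ : W.toAffine.Equation x₃ y₃) {γ : Γ₀} (hγ : γ ≤ 1) (hγ₁ : v (x₁ / y₁) ≤ γ)
    (hγ₂ : v (x₂ / y₂) ≤ γ) :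
    v (x₃ / y₃) ≤ γ ∧ v (x₁ / y₁ + x₂ / y₂ + x₃ / y₃) ≤ γ ^ 2 := by
  obtain ⟨h₃, hm0, hvm, hσ⟩ := hl.ker hW h₁ h₂ e₃
  obtain ⟨h1, h2, h3, h4, h6⟩ := hW
  have hx₁ := h₁.x_ne
  have hx₂ := h₂.x_ne
  have hx₃ := h₃.x_ne
  have hy₁ := h₁.y_ne
  have hy₂ := h₂.y_ne
  have hy₃ := h₃.y_ne
  have hz₁ : v (x₁ / y₁) ≤ 1 := h₁.z_lt.le
  have hz₂ : v (x₂ / y₂) ≤ 1 := h₂.z_lt.le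
  have hw₂ : v y₂⁻¹ ≤ 1 := by
    rw [map_inv₀, h₂.vy, inv_inv]; exact pow_le_one' hz₂ 3
  have hγ₃ : v (x₃ / y₃) ≤ γ := by
    rw [hσ]
    have h0 : x₁ / y₁ + x₂ / y₂ + W.a₁ * (x₁ / y₁) * (x₂ / y₂) + W.a₃ * (x₁ / y₁) * y₂⁻¹ =
      (x₁ / y₁) * (1 + W.a₁ * (x₂ / y₂) + W.a₃ * y₂⁻¹) + x₂ / y₂ := by ring
    rw [h0]
    exact v.map_add_le (vmul_le_left hγ₁ (by apply_rules [vle_add, vle_mul, vle_one])) hγ₂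
  refine ⟨hγ₃, ?_⟩
  set g₁ := v (x₁ / y₁) with hg₁
  set g₂ := v (x₂ / y₂) with hg₂
  set g₃ := v (x₃ / y₃) with hg₃
  have hg₁0 : g₁ ≠ 0 := v.ne_zero_iff.mpr (div_ne_zero hx₁ hy₁)
  have hg₂0 : g₂ ≠ 0 := v.ne_zero_iff.mpr (div_ne_zero hx₂ hy₂)
  have hg₃0 : g₃ ≠ 0 := v.ne_zero_iff.mpr (div_ne_zero hx₃ hy₃)
  have hmi : v m⁻¹ ≤ γ ^ 3 := by
    rw [map_inv₀, hvm, inv_inv, pow_succ, pow_two]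
    exact mul_le_mul' (mul_le_mul' hγ₁ hγ₂) hγ₃
  have hγ32 : γ ^ 3 ≤ γ ^ 2 := pow_le_pow_right_of_le_one' hγ (by norm_num)
  have hγ64 : γ ^ 3 * γ ^ 3 ≤ γ ^ 4 := by
    rw [← pow_add]; exact pow_le_pow_right_of_le_one' hγ (by norm_num)
  have hmi2 : v m⁻¹ ≤ γ ^ 2 := hmi.trans hγ32
  have hmi1 : v m⁻¹ ≤ 1 := hmi2.trans (pow_le_one' hγ 2)
  set lam := ℓ * m⁻¹ with hlam
  have hlam2 : v lam ≤ γ ^ 2 := by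
    -- If `lam` exceeded γ², it would dominate m⁻¹a₁, so the left side of `hq` would have valuation
    -- v(lam)² > γ⁴; every term on the right is at most γ⁴.
    by_contra! hlt
    have hq : lam * (lam + m⁻¹ * W.a₁) =
        x₁ * m⁻¹ ^ 2 + x₂ * m⁻¹ ^ 2 + x₃ * m⁻¹ ^ 2 + m⁻¹ * m⁻¹ * W.a₂ := by
      rw [hlam]
      linear_combination (-m⁻¹ ^ 2) * hl.e₁
    have hx : ∀ {x : F} {a b c : Γ₀}, v m = (a * b * c)⁻¹ → v x = (a ^ 2)⁻¹ → a ≠ 0 → b ≤ γ →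
        c ≤ γ → v (x * m⁻¹ ^ 2) ≤ γ ^ 4 := by
      intro x a b c hm hx ha hb hc
      rw [map_mul, map_pow, map_inv₀, hm, hx, inv_inv]
      have h5 : (a ^ 2)⁻¹ * (a * b * c) ^ 2 = b ^ 2 * c ^ 2 := by field_simp
      rw [h5]
      calc b ^ 2 * c ^ 2 ≤ γ ^ 2 * γ ^ 2 :=
            mul_le_mul' (pow_le_pow_left' hb 2) (pow_le_pow_left' hc 2)
        _ = γ ^ 4 := by rw [← pow_add]
    have hle : v (lam * (lam + m⁻¹ * W.a₁)) ≤ γ ^ 4 := by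
      rw [hq]
      refine v.map_add_le (v.map_add_le (v.map_add_le ?_ ?_) ?_) ?_
      · exact hx hvm h₁.vx hg₁0 hγ₂ hγ₃
      · exact hx (a := g₂) (b := g₁) (c := g₃) (by rw [hvm]; congr 1; ac_rfl) h₂.vx hg₂0 hγ₁ hγ₃
      · exact hx (a := g₃) (b := g₁) (c := g₂) (by rw [hvm]; congr 1; ac_rfl) h₃.vx hg₃0 hγ₁ hγ₂
      · exact (vmul_le_left (vmul_le hmi hmi) h2).trans hγ64
    have heq : v (lam + m⁻¹ * W.a₁) = v lam :=
      v.map_add_eq_of_lt_left ((vmul_le_left hmi2 h1).trans_lt hlt)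
    rw [map_mul, heq, ← pow_two] at hle
    have h5 : γ ^ 4 < v lam ^ 2 := by
      rw [show γ ^ 4 = (γ ^ 2) ^ 2 by rw [← pow_mul]]
      exact pow_lt_pow_left₀ hlt zero_le (by norm_num)
    exact absurd hle (not_le.mpr h5)
  have hlam1 : v lam ≤ 1 := hlam2.trans (pow_le_one' hγ 2)
  -- The prefactor is a unit because v(m) = (g₁g₂g₃)⁻¹ and v(yᵢ) = gᵢ⁻³; each remaining term
  -- contains `lam` or m⁻¹.
  have hz : x₁ / y₁ + x₂ / y₂ + x₃ / y₃ = (m ^ 3 * (y₁ * y₂ * y₃)⁻¹) *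
      (lam * (-W.a₁ + 2 * W.a₄ * m⁻¹ + W.a₃ * lam - 3 * W.a₆ * (lam * m⁻¹)) + m⁻¹ * (-W.a₂)) := by
    rw [hlam]
    have ha2 : W.a₂ = ℓ ^ 2 + W.a₁ * ℓ - (x₁ + x₂ + x₃) := by linear_combination hl.e₁
    have ha4 : W.a₄ = x₁ * x₂ + x₁ * x₃ + x₂ * x₃ + 2 * ℓ * m + W.a₁ * m + W.a₃ * ℓ := by
      linear_combination -hl.e₂
    have ha6 : W.a₆ = m ^ 2 + W.a₃ * m - x₁ * x₂ * x₃ := by linear_combination hl.e₃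
    field_simp
    rw [ha2, ha4, ha6, hl.y₁, hl.y₂, hl.y₃]
    ring
  rw [hz]
  have hunit : v (m ^ 3 * (y₁ * y₂ * y₃)⁻¹) = 1 := by
    rw [map_mul, map_pow, map_inv₀, map_mul, map_mul, hvm, h₁.vy, h₂.vy, h₃.vy, ← hg₁, ← hg₂, ← hg₃]
    field_simp
  rw [map_mul, hunit, one_mul]
  exact v.map_add_le (vmul_le_left hlam2
    (by apply_rules [vle_add, vle_sub, vle_mul, vle_neg, vle_ofNat]))
    (vmul_le_left hmi2 (vle_neg h2))

/-- If the line through two points of nonsingular reduction has a slope that is not integral, the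
third point is in the kernel of reduction. -/
lemma IsLine.one_lt_of_congr (hW : IntegralCoeffs v W) {ℓ m x₁ y₁ x₂ y₂ x₃ y₃ : F}
    (hl : IsLine W ℓ m x₁ y₁ x₂ (W.toAffine.negY x₂ y₂) x₃ y₃) (hx₁ : v x₁ ≤ 1)
    (hx₂ : v x₂ ≤ 1) (hx : v (x₁ - x₂) < 1) (hy : v (y₁ - y₂) < 1)
    (hns : v (3 * x₁ ^ 2 + 2 * W.a₂ * x₁ + W.a₄ - W.a₁ * y₁) = 1 ∨
      v (2 * y₁ + W.a₁ * x₁ + W.a₃) = 1) : 1 < v x₃ := by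
  obtain ⟨h1, h2, h3, h4, h6⟩ := hW
  have hℓ : 1 < v ℓ := by
    -- With an integral slope, `key1` and `key2` would make both partial derivatives at the first
    -- point non-units, contradicting `hns`.
    by_contra! hle
    have key1 : ℓ * (y₁ - y₂) = (3 * x₁ ^ 2 + 2 * W.a₂ * x₁ + W.a₄ - W.a₁ * y₁) -
        (x₁ - x₂) * (2 * x₁ + x₂ + W.a₂) := by
      have h5 : -y₂ - W.a₁ * x₂ - W.a₃ = ℓ * x₂ + m := hl.y₂
      have h6 : y₂ = -(ℓ * x₂ + m) - W.a₁ * x₂ - W.a₃ := by linear_combination -h5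
      have ha2 : W.a₂ = ℓ ^ 2 + W.a₁ * ℓ - (x₁ + x₂ + x₃) := by linear_combination hl.e₁
      have ha4 : W.a₄ = x₁ * x₂ + x₁ * x₃ + x₂ * x₃ + 2 * ℓ * m + W.a₁ * m + W.a₃ * ℓ := by
        linear_combination -hl.e₂
      rw [h6, ha2, ha4, hl.y₁]
      ring
    have key2 : ℓ * (x₁ - x₂) = (2 * y₁ + W.a₁ * x₁ + W.a₃) - ((y₁ - y₂) + W.a₁ * (x₁ - x₂)) := by
      have h5 : -y₂ - W.a₁ * x₂ - W.a₃ = ℓ * x₂ + m := hl.y₂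
      linear_combination h5 - hl.y₁
    rcases hns with h | h
    · have h5 : v (ℓ * (y₁ - y₂) + (x₁ - x₂) * (2 * x₁ + x₂ + W.a₂)) < 1 :=
        v.map_add_lt (by rw [mul_comm]; exact vlt_mul hy hle)
          (vlt_mul hx (by apply_rules [vle_add, vle_mul, vle_ofNat]))
      rw [key1, sub_add_cancel, h] at h5
      exact lt_irrefl _ h5
    · have h5 : v (ℓ * (x₁ - x₂) + ((y₁ - y₂) + W.a₁ * (x₁ - x₂))) < 1 :=
        v.map_add_lt (by rw [mul_comm]; exact vlt_mul hx hle)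
          (v.map_add_lt hy (by rw [mul_comm]; exact vlt_mul hx h1))
      rw [key2, sub_add_cancel, h] at h5
      exact lt_irrefl _ h5
  have hℓ0 : ℓ ≠ 0 := by
    rintro rfl
    simp at hℓ
  have hi : v ℓ⁻¹ < 1 := by
    rw [map_inv₀]; exact inv_lt_one_of_one_lt₀ hℓ
  have hi' := hi.le
  have h5 : x₃ = ℓ ^ 2 * (1 + ℓ⁻¹ * (W.a₁ - (W.a₂ + x₁ + x₂) * ℓ⁻¹)) := by
    field_simp
    linear_combination hl.e₁
  rw [h5, map_mul, map_pow, vunit_one_add (vlt_mul hi (by apply_rules [vle_add, vle_sub, vle_mul])),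
    mul_one]
  exact one_lt_pow₀ hℓ (by norm_num)

end Estimates

/-! ### The kernel of reduction and its filtration by the parameter z. -/

section Kernel

open WeierstrassCurve.Affine

variable {F : Type*} [Field F] {Γ₀ : Type*} [LinearOrderedCommGroupWithZero Γ₀]
  {v : Valuation F Γ₀} {W : WeierstrassCurve F}

/-- The function `x / y` on the points of a Weierstrass curve, a parameter at the origin. -/
def zCoord : W.toAffine.Point → F
  | .zero => 0
  | .some x y _ => x / y

/-- A point in the kernel of reduction. -/
def InKer (v : Valuation F Γ₀) : W.toAffine.Point → Prop
  | .zero => True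
  | .some x _ _ => 1 < v x

@[simp] lemma zCoord_zero : zCoord (0 : W.toAffine.Point) = 0 := rfl

@[simp] lemma zCoord_some {x y : F} (h : W.toAffine.Nonsingular x y) :
    zCoord (.some x y h : W.toAffine.Point) = x / y := rfl

lemma inKer_zero : InKer v (0 : W.toAffine.Point) := trivial

lemma inKer_some {x y : F} (h : W.toAffine.Nonsingular x y) :
    InKer v (.some x y h : W.toAffine.Point) ↔ 1 < v x := Iff.rfl

lemma zCoord_lt_one (hW : IntegralCoeffs v W) {P : W.toAffine.Point} (hP : InKer v P) :
    v (zCoord P) < 1 := by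
  rcases P with _ | ⟨x, y, h⟩
  · change v 0 < 1
    simp
  · exact (isKer_of_one_lt hW h.1 hP).z_lt

lemma zCoord_eq_zero (hW : IntegralCoeffs v W) {P : W.toAffine.Point} (hP : InKer v P)
    (h0 : zCoord P = 0) : P = 0 := by
  rcases P with _ | ⟨x, y, h⟩
  · rfl
  · have := isKer_of_one_lt hW h.1 hP
    exact absurd h0 (div_ne_zero this.x_ne this.y_ne)

lemma InKer.neg {P : W.toAffine.Point} (hP : InKer v P) : InKer v (-P) := by
  rcases P with _ | ⟨x, y, h⟩
  · exact hP
  · exact hP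

/-- All three claims follow from z(-P) = -z(P)/(1 + d), where v(d) ≤ v(z(P)) and hence 1 + d is a
unit. The third serves to rewrite the expression in `IsLine.ker` as a difference of z-coordinates.
At the origin the inverse is set to 0, which is harmless because it is multiplied by z = 0. -/
lemma val_zCoord_neg_add (hW : IntegralCoeffs v W) {P : W.toAffine.Point} (hP : InKer v P) :
    v (zCoord (-P) + zCoord P) ≤ v (zCoord P) ^ 2 ∧ v (zCoord (-P)) = v (zCoord P) ∧
      ∀ z, v (z - zCoord (-P)) = v (z * (1 + W.a₁ * zCoord P + W.a₃ * (zCoord P *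
        (match P with | .zero => 0 | .some x _ _ => x⁻¹))) + zCoord P) := by
  rcases P with _ | ⟨x, y, h⟩
  · change v (0 + 0) ≤ v 0 ^ 2 ∧ v 0 = v 0 ∧
      ∀ z, v (z - 0) = v (z * (1 + W.a₁ * 0 + W.a₃ * (0 * 0)) + 0)
    simp
  · have hk := isKer_of_one_lt hW h.1 hP
    have hx := hk.x_ne
    have hy := hk.y_ne
    have hu : v x⁻¹ ≤ 1 := by
      rw [map_inv₀]; exact inv_le_one_of_one_le₀ hk.one_lt.le
    rw [Point.neg_some, zCoord_some, zCoord_some]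
    simp only
    have hd : v (W.a₁ * (x / y) + W.a₃ * (x / y * x⁻¹)) ≤ v (x / y) := by
      rw [show W.a₁ * (x / y) + W.a₃ * (x / y * x⁻¹) = (x / y) * (W.a₁ + W.a₃ * x⁻¹) by ring]
      exact vmul_le_left le_rfl (vle_add hW.a₁ (vle_mul hW.a₃ hu))
    set d := W.a₁ * (x / y) + W.a₃ * (x / y * x⁻¹) with hdd
    have hD : v (1 + d) = 1 := vunit_one_add (hd.trans_lt hk.z_lt)
    have hD0 : 1 + d ≠ 0 := v.ne_zero_iff.mp (by rw [hD]; exact one_ne_zero)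
    have hz : x / W.toAffine.negY x y = -(x / y) * (1 + d)⁻¹ := by
      have h5 : W.toAffine.negY x y = -(y * (1 + d)) := by
        rw [negY, hdd]; field_simp; ring
      rw [h5]; field_simp
    rw [hz, add_assoc, ← hdd]
    refine ⟨?_, ?_, fun z => ?_⟩
    · rw [show -(x / y) * (1 + d)⁻¹ + x / y = (x / y) * d * (1 + d)⁻¹ by field_simp; ring, map_mul,
        map_inv₀, hD, inv_one, mul_one, pow_two]
      exact vmul_le le_rfl hd
    · rw [map_mul, map_inv₀, hD, inv_one, mul_one, v.map_neg]
    · rw [show z - -(x / y) * (1 + d)⁻¹ = (z * (1 + d) + x / y) * (1 + d)⁻¹ by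
        field_simp; ring, map_mul,
        map_inv₀, hD, inv_one, mul_one]

variable [DecidableEq F]

/-- The exact valuation matters: applied to -Q it makes z an isometry for differences of points
(`inKer_sub`), so convergence of points can be tested on z. -/
lemma inKer_add (hW : IntegralCoeffs v W) {P Q : W.toAffine.Point} (hP : InKer v P)
    (hQ : InKer v Q) :
    InKer v (P + Q) ∧ v (zCoord (P + Q)) = v (zCoord P - zCoord (-Q)) := by
  rcases P with _ | ⟨x₁, y₁, h₁⟩
  · change InKer v (0 + Q) ∧ v (zCoord (0 + Q)) = v (0 - zCoord (-Q))
    rw [zero_add, zero_sub, v.map_neg]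
    exact ⟨hQ, (val_zCoord_neg_add hW hQ).2.1.symm⟩
  rcases hQ' : Q with _ | ⟨x₂, y₂, h₂⟩
  · change InKer v (_ + 0) ∧ v (zCoord (_ + 0)) = v (_ - zCoord (-0))
    rw [add_zero, neg_zero, zCoord_zero, sub_zero]
    exact ⟨hP, rfl⟩
  rw [hQ'] at hQ
  by_cases hxy : x₁ = x₂ ∧ y₁ = W.toAffine.negY x₂ y₂
  · have hneg : -Point.some x₂ y₂ h₂ = Point.some x₁ y₁ h₁ := by
      rw [Point.neg_some, Point.some.injEq]
      exact ⟨hxy.1.symm, hxy.2.symm⟩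
    rw [Point.add_of_Y_eq hxy.1 hxy.2, hneg, sub_self]
    exact ⟨trivial, rfl⟩
  · obtain ⟨ℓ, m, x₃, y₃, h₃, hs, hl⟩ := exists_isLine h₁ h₂ hxy
    have k₁ := isKer_of_one_lt hW h₁.1 hP
    have k₂ := isKer_of_one_lt hW h₂.1 hQ
    obtain ⟨k₃, -, -, hσ⟩ := hl.ker hW k₁ k₂ h₃.1
    have hk₃ : InKer v (Point.some x₃ y₃ h₃) := k₃.one_lt
    rw [hs]
    refine ⟨hk₃.neg, ?_⟩
    rw [(val_zCoord_neg_add hW hk₃).2.1, (val_zCoord_neg_add hW hQ).2.2, zCoord_some, hσ,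
      zCoord_some, zCoord_some]
    congr 1
    have := k₂.x_ne
    field_simp
    ring

lemma val_zCoord_add_sub_le (hW : IntegralCoeffs v W) {P Q : W.toAffine.Point} (hP : InKer v P)
    (hQ : InKer v Q) {γ : Γ₀} (hγP : v (zCoord P) ≤ γ) (hγQ : v (zCoord Q) ≤ γ) (hγ : γ ≤ 1) :
    v (zCoord (P + Q) - zCoord P - zCoord Q) ≤ γ ^ 2 := by
  rcases P with _ | ⟨x₁, y₁, h₁⟩
  · change v (zCoord (0 + Q) - 0 - zCoord Q) ≤ _
    simp
  rcases hQ' : Q with _ | ⟨x₂, y₂, h₂⟩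
  · change v (zCoord (_ + 0) - _ - 0) ≤ _
    simp
  rw [hQ'] at hQ hγQ
  by_cases hxy : x₁ = x₂ ∧ y₁ = W.toAffine.negY x₂ y₂
  · have hneg : Point.some x₁ y₁ h₁ = -Point.some x₂ y₂ h₂ := by
      rw [Point.neg_some, Point.some.injEq]
      exact hxy
    rw [hneg, neg_add_cancel, zCoord_zero, zero_sub, ← neg_add', v.map_neg]
    exact (val_zCoord_neg_add hW hQ).1.trans (pow_le_pow_left' hγQ 2)
  · obtain ⟨ℓ, m, x₃, y₃, h₃, hs, hl⟩ := exists_isLine h₁ h₂ hxy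
    have k₁ := isKer_of_one_lt hW h₁.1 hP
    have k₂ := isKer_of_one_lt hW h₂.1 hQ
    obtain ⟨k₃, -, -, hσ⟩ := hl.ker hW k₁ k₂ h₃.1
    obtain ⟨hγ₃, hsum⟩ := hl.val_z_add_le hW k₁ k₂ h₃.1 hγ hγP hγQ
    have hk₃ : InKer v (Point.some x₃ y₃ h₃) := k₃.one_lt
    rw [hs]
    have h5 : zCoord (-Point.some x₃ y₃ h₃) - zCoord (Point.some x₁ y₁ h₁) -
        zCoord (Point.some x₂ y₂ h₂) = (zCoord (-Point.some x₃ y₃ h₃) +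
          zCoord (Point.some x₃ y₃ h₃)) - (x₁ / y₁ + x₂ / y₂ + x₃ / y₃) := by
      simp only [zCoord_some]; ring
    rw [h5]
    exact v.map_sub_le ((val_zCoord_neg_add hW hk₃).1.trans (pow_le_pow_left' hγ₃ 2)) hsum

lemma inKer_sub (hW : IntegralCoeffs v W) {P Q : W.toAffine.Point} (hP : InKer v P)
    (hQ : InKer v Q) :
    InKer v (P - Q) ∧ v (zCoord (P - Q)) = v (zCoord P - zCoord Q) := by
  rw [sub_eq_add_neg]
  simpa using inKer_add hW hP hQ.neg

/-- The points of the kernel of reduction at which `x / y` has valuation at most `γ`. -/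
def kerFiltration (hW : IntegralCoeffs v W) (γ : Γ₀) : AddSubgroup W.toAffine.Point where
  carrier := {P | InKer v P ∧ v (zCoord P) ≤ γ}
  zero_mem' := ⟨trivial, by simp⟩
  add_mem' := by
    rintro P Q ⟨hP, hP'⟩ ⟨hQ, hQ'⟩
    refine ⟨(inKer_add hW hP hQ).1, ?_⟩
    rw [(inKer_add hW hP hQ).2]
    exact v.map_sub_le hP' (by rwa [(val_zCoord_neg_add hW hQ).2.1])
  neg_mem' := by
    rintro P ⟨hP, hP'⟩
    exact ⟨hP.neg, by rwa [(val_zCoord_neg_add hW hP).2.1]⟩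

lemma mem_kerFiltration {hW : IntegralCoeffs v W} {γ : Γ₀} {P : W.toAffine.Point} :
    P ∈ kerFiltration hW γ ↔ InKer v P ∧ v (zCoord P) ≤ γ := Iff.rfl

/-- The kernel of reduction. -/
def kerReduction (hW : IntegralCoeffs v W) : AddSubgroup W.toAffine.Point where
  carrier := {P | InKer v P}
  zero_mem' := trivial
  add_mem' hP hQ := (inKer_add hW hP hQ).1
  neg_mem' hP := hP.neg

lemma val_zCoord_nsmul_sub_le (hW : IntegralCoeffs v W) {P : W.toAffine.Point} (hP : InKer v P)
    (n : ℕ) : v (zCoord (n • P) - n * zCoord P) ≤ v (zCoord P) ^ 2 := by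
  have hγ := (zCoord_lt_one hW hP).le
  induction n with
  | zero => simp
  | succ k ih =>
    have hk : k • P ∈ kerFiltration hW (v (zCoord P)) :=
      AddSubgroup.nsmul_mem _ (show P ∈ kerFiltration hW (v (zCoord P)) from ⟨hP, le_rfl⟩) k
    have h := val_zCoord_add_sub_le hW hk.1 hP hk.2 le_rfl hγ
    rw [succ_nsmul]
    have h5 : zCoord (k • P + P) - ((k + 1 : ℕ) : F) * zCoord P =
        (zCoord (k • P + P) - zCoord (k • P) - zCoord P) + (zCoord (k • P) - k * zCoord P) := by
      push_cast; ring
    rw [h5]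
    exact v.map_add_le h ih

/-- Since z(nP) is n z(P) up to z(P)², an integer n of small valuation acts as a contraction. This
is the engine behind the invertibility of p. -/
lemma val_zCoord_nsmul_le (hW : IntegralCoeffs v W) {P : W.toAffine.Point} (hP : InKer v P)
    {n : ℕ} {δ : Γ₀} (hn : v (n : F) ≤ δ) (hz : v (zCoord P) ≤ δ) :
    v (zCoord (n • P)) ≤ δ * v (zCoord P) := by
  have h5 : zCoord (n • P) = (zCoord (n • P) - n * zCoord P) + n * zCoord P := by ring
  rw [h5]
  refine v.map_add_le ((val_zCoord_nsmul_sub_le hW hP n).trans ?_) (vmul_le hn le_rfl)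
  rw [pow_two]
  exact mul_le_mul' hz le_rfl

end Kernel

/-! ### Completeness and Newton iteration. -/

section Complete

open WeierstrassCurve.Affine WithZero

variable {F : Type*} [Field F] {v : Valuation F ℤᵐ⁰} {W : WeierstrassCurve F}

/-- Sequences of geometric rate of convergence converge. -/
def HasLimits (v : Valuation F ℤᵐ⁰) : Prop :=
  ∀ x : ℕ → F, (∀ n, v (x (n + 1) - x n) ≤ exp (-(n : ℤ))) →
    ∃ l, ∀ n, v (l - x n) ≤ exp (-(n : ℤ))

lemma le_exp_neg_one {γ : ℤᵐ⁰} (h : γ < 1) : γ ≤ exp (-1 : ℤ) := by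
  rcases eq_or_ne γ 0 with rfl | h0
  · exact zero_le
  · rw [← exp_log h0] at h ⊢
    rw [← exp_zero, exp_lt_exp] at h
    rw [exp_le_exp]
    lia

lemma exp_neg_one_lt_one : exp (-1 : ℤ) < (1 : ℤᵐ⁰) := by
  rw [← exp_zero, exp_lt_exp]; lia

lemma eq_zero_of_forall_le_exp {γ : ℤᵐ⁰} (h : ∀ n : ℕ, γ ≤ exp (-(n : ℤ))) : γ = 0 := by
  by_contra h0
  have h1 := h ((-log γ).toNat + 1)
  rw [← exp_log h0, exp_le_exp, log_exp] at h1
  lia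

/-- Newton's method. -/
lemma exists_root_of_approx (hv : HasLimits v) {f : F → F} {d x₀ : F} (hd : v d = 1)
    (h₀ : v (f x₀) < 1)
    (hf : ∀ x h, v (x - x₀) < 1 → v h < 1 → v (f (x + h) - f x - d * h) ≤ exp (-1 : ℤ) * v h) :
    ∃ x, f x = 0 ∧ v (x - x₀) < 1 := by
  have hd0 : d ≠ 0 := v.ne_zero_iff.mp (by rw [hd]; exact one_ne_zero)
  -- The derivative is frozen at the unit `d`. Convergence is then only linear, by a factor exp(-1)
  -- per step, which is enough for `HasLimits`.
  let x : ℕ → F := fun n => Nat.rec x₀ (fun _ y => y + -(f y / d)) n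
  have hx : ∀ n, x (n + 1) = x n + -(f (x n) / d) := fun n => rfl
  have hh : ∀ n, v (-(f (x n) / d)) = v (f (x n)) := fun n => by
    rw [v.map_neg, map_div₀, hd, div_one]
  have key : ∀ n, v (x n - x₀) < 1 ∧ v (f (x n)) ≤ exp (-((n + 1 : ℕ) : ℤ)) := by
    intro n
    induction n with
    | zero => exact ⟨by simp [x], by simpa [x] using le_exp_neg_one h₀⟩
    | succ n ih =>
      have hlt : v (-(f (x n) / d)) < 1 := by
        rw [hh]
        exact ih.2.trans_lt (by rw [← exp_zero, exp_lt_exp]; lia)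
      refine ⟨?_, ?_⟩
      · rw [hx, add_sub_right_comm]
        exact v.map_add_lt ih.1 hlt
      · have h1 := hf _ _ ih.1 hlt
        have h2 : f (x n + -(f (x n) / d)) - f (x n) - d * -(f (x n) / d) = f (x (n + 1)) := by
          rw [hx]; field_simp; ring
        rw [h2, hh] at h1
        refine h1.trans ((mul_le_mul' le_rfl ih.2).trans ?_)
        rw [← exp_add, exp_le_exp]
        push_cast
        lia
  obtain ⟨l, hl⟩ := hv x fun n => by
    rw [hx, add_sub_cancel_left, hh]
    exact (key n).2.trans (by rw [exp_le_exp]; push_cast; lia)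
  refine ⟨l, ?_, ?_⟩
  · rw [← v.zero_iff]
    refine eq_zero_of_forall_le_exp fun n => ?_
    have hlt : v (l - x (n + 1)) < 1 :=
      (hl (n + 1)).trans_lt (by rw [← exp_zero, exp_lt_exp]; push_cast; lia)
    have h1 := hf _ _ (key (n + 1)).1 hlt
    have hle : v (l - x (n + 1)) ≤ exp (-(n : ℤ)) :=
      (hl (n + 1)).trans (by rw [exp_le_exp]; push_cast; lia)
    have h2 : f l = (f (x (n + 1) + (l - x (n + 1))) - f (x (n + 1)) - d * (l - x (n + 1))) +
        (f (x (n + 1)) + d * (l - x (n + 1))) := by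
      rw [add_sub_cancel]; ring
    rw [h2]
    refine v.map_add_le (h1.trans ?_) (v.map_add_le ((key (n + 1)).2.trans ?_) ?_)
    · exact (mul_le_of_le_one_left' exp_neg_one_lt_one.le).trans hle
    · rw [exp_le_exp]; push_cast; lia
    · rw [map_mul, hd, one_mul]; exact hle
  · have h1 := v.map_add_lt ((hl 1).trans_lt (by simpa using exp_neg_one_lt_one)) (key 1).1
    simpa using h1

end Complete

/-! ### Good reduction: smoothness and finite index of the kernel. -/

section Smooth

open WeierstrassCurve.Affine

variable {F : Type*} [Field F] {Γ₀ : Type*} [LinearOrderedCommGroupWithZero Γ₀]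
  {v : Valuation F Γ₀} {W : WeierstrassCurve F}

/-- A curve of good reduction has nonsingular reduction everywhere. -/
lemma val_partial_eq_one (hW : IntegralCoeffs v W) (hΔ : v W.Δ = 1) {x y : F} (hx : v x ≤ 1)
    (hy : v y ≤ 1) (h : v (y ^ 2 + W.a₁ * x * y + W.a₃ * y -
      (x ^ 3 + W.a₂ * x ^ 2 + W.a₄ * x + W.a₆)) < 1) :
    v (3 * x ^ 2 + 2 * W.a₂ * x + W.a₄ - W.a₁ * y) = 1 ∨ v (2 * y + W.a₁ * x + W.a₃) = 1 := by
  obtain ⟨h1, h2, h3, h4, h6⟩ := hW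
  let O := v.valuationSubring
  let W₀ : WeierstrassCurve O := ⟨⟨W.a₁, h1⟩, ⟨W.a₂, h2⟩, ⟨W.a₃, h3⟩, ⟨W.a₄, h4⟩, ⟨W.a₆, h6⟩⟩
  let x₀ : O := ⟨x, hx⟩
  let y₀ : O := ⟨y, hy⟩
  have hlt : ∀ a : O, IsLocalRing.residue O a = 0 ↔ v (a : F) < 1 := fun a => by
    rw [IsLocalRing.residue_eq_zero_iff]
    exact Valuation.mem_maximalIdeal_iff ..
  -- Over the residue field a nonzero discriminant makes every point of the curve nonsingular, and a
  -- nonzero residue lifts to an element of valuation one.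
  have hΔ' : (W₀.map (IsLocalRing.residue O)).Δ ≠ 0 := by
    rw [WeierstrassCurve.map_Δ, Ne, hlt]
    have : ((W₀.Δ : O) : F) = W.Δ := by
      have h5 : W₀.map O.subtype = W := rfl
      rw [← h5, WeierstrassCurve.map_Δ]
      rfl
    rw [this, hΔ]
    exact lt_irrefl _
  have heq : (W₀.map (IsLocalRing.residue O)).toAffine.Equation
      (IsLocalRing.residue O x₀) (IsLocalRing.residue O y₀) := by
    rw [equation_iff']
    have h5 := (hlt (y₀ ^ 2 + W₀.a₁ * x₀ * y₀ + W₀.a₃ * y₀ -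
      (x₀ ^ 3 + W₀.a₂ * x₀ ^ 2 + W₀.a₄ * x₀ + W₀.a₆))).mpr h
    simpa using h5
  rw [equation_iff_nonsingular_of_Δ_ne_zero hΔ', nonsingular_iff'] at heq
  refine heq.2.imp (fun h5 => ?_) (fun h5 => ?_)
  · have h6 := (hlt (3 * x₀ ^ 2 + 2 * W₀.a₂ * x₀ + W₀.a₄ - W₀.a₁ * y₀)).not.mp (by
      intro h7
      apply h5
      simp only [map_sub, map_add, map_mul, map_pow, map_ofNat] at h7
      simp only [WeierstrassCurve.map_a₁, WeierstrassCurve.map_a₂, WeierstrassCurve.map_a₄]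
      linear_combination -h7)
    exact le_antisymm (by apply_rules [vle_add, vle_sub, vle_mul, vle_pow, vle_ofNat])
      (not_lt.mp h6)
  · have h6 := (hlt (2 * y₀ + W₀.a₁ * x₀ + W₀.a₃)).not.mp (by
      intro h7
      apply h5
      simp only [map_add, map_mul, map_ofNat] at h7
      simp only [WeierstrassCurve.map_a₁, WeierstrassCurve.map_a₃]
      linear_combination h7)
    exact le_antisymm (by apply_rules [vle_add, vle_sub, vle_mul, vle_pow, vle_ofNat])
      (not_lt.mp h6)

lemma val_y_le_one (hW : IntegralCoeffs v W) {x y : F} (h : W.toAffine.Equation x y)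
    (hx : v x ≤ 1) : v y ≤ 1 := by
  obtain ⟨h1, h2, h3, h4, h6⟩ := hW
  rw [equation_iff] at h
  by_contra! hy
  have hi : v y⁻¹ < 1 := by
    rw [map_inv₀]; exact inv_lt_one_of_one_lt₀ hy
  have hy0 : y ≠ 0 := by
    rintro rfl
    simp at hy
  have h5 : v (y ^ 2 + W.a₁ * x * y + W.a₃ * y) ≤ 1 := by
    rw [h]
    apply_rules [vle_add, vle_mul, vle_pow]
  have h7 : y ^ 2 + W.a₁ * x * y + W.a₃ * y = y ^ 2 * (1 + y⁻¹ * (W.a₁ * x + W.a₃)) := by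
    field_simp; ring
  rw [h7, map_mul, map_pow, vunit_one_add (vlt_mul hi (by apply_rules [vle_add, vle_mul])),
    mul_one] at h5
  exact absurd h5 (not_le.mpr (one_lt_pow₀ hy (by norm_num)))

variable [DecidableEq F]

/-- Points with the same reduction differ by a point in the kernel of reduction. -/
lemma inKer_sub_of_congr (hW : IntegralCoeffs v W) (hΔ : v W.Δ = 1) {x₁ y₁ x₂ y₂ : F}
    (h₁ : W.toAffine.Nonsingular x₁ y₁) (h₂ : W.toAffine.Nonsingular x₂ y₂) (hx₁ : v x₁ ≤ 1)
    (hx₂ : v x₂ ≤ 1) (hx : v (x₁ - x₂) < 1) (hy : v (y₁ - y₂) < 1) :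
    InKer v (Point.some x₁ y₁ h₁ - Point.some x₂ y₂ h₂) := by
  rw [sub_eq_add_neg, Point.neg_some]
  by_cases hxy : x₁ = x₂ ∧ y₁ = W.toAffine.negY x₂ (W.toAffine.negY x₂ y₂)
  · rw [Point.add_of_Y_eq hxy.1 hxy.2]
    exact inKer_zero
  · obtain ⟨ℓ, m, x₃, y₃, h₃, hs, hl⟩ := exists_isLine h₁ ((nonsingular_neg ..).mpr h₂) hxy
    rw [hs]
    have hn := val_partial_eq_one hW hΔ hx₁ (val_y_le_one hW h₁.1 hx₁) (by
      rw [(W.toAffine.equation_iff x₁ y₁).mp h₁.1, sub_self, map_zero]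
      exact zero_lt_one)
    exact InKer.neg (P := Point.some x₃ y₃ h₃) (hl.one_lt_of_congr hW hx₁ hx₂ hx hy hn)

/-- The kernel of reduction has finite index if the residue field is finite. -/
lemma finite_quotient_kerReduction (hW : IntegralCoeffs v W) (hΔ : v W.Δ = 1) {κ : Type*} [Finite κ]
    (r : F → κ) (hr : ∀ x y, v x ≤ 1 → v y ≤ 1 → r x = r y → v (x - y) < 1) :
    Finite (W.toAffine.Point ⧸ kerReduction hW) := by
  classical
  -- `Φ` is the reduction map as a mere map of sets; `r` only has to separate residue classes, so no
  -- ring structure on `κ` is needed.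
  let Φ : W.toAffine.Point → Option (κ × κ) := fun P => match P with
    | .zero => none
    | .some x y _ => if 1 < v x then none else some (r x, r y)
  have hnone : ∀ P, Φ P = none → InKer v P := by
    rintro (_ | ⟨x, y, h⟩) hP
    · exact trivial
    · by_contra hx
      have : ¬ 1 < v x := hx
      simp [Φ, this] at hP
  have hΦ : ∀ P Q, Φ P = Φ Q → P - Q ∈ kerReduction hW := by
    intro P Q h
    rcases hP : Φ P with _ | c
    · exact (inKer_sub hW (hnone P hP) (hnone Q (h ▸ hP))).1
    · have hQ : Φ Q = some c := h ▸ hP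
      rcases P with _ | ⟨x₁, y₁, h₁⟩
      · simp [Φ] at hP
      rcases Q with _ | ⟨x₂, y₂, h₂⟩
      · simp [Φ] at hQ
      by_cases hx₁ : 1 < v x₁
      · simp [Φ, hx₁] at hP
      by_cases hx₂ : 1 < v x₂
      · simp [Φ, hx₂] at hQ
      rw [not_lt] at hx₁ hx₂
      simp only [Φ, not_lt.mpr hx₁, not_lt.mpr hx₂, if_false, Option.some.injEq, Prod.mk.injEq] at h
      exact inKer_sub_of_congr hW hΔ h₁ h₂ hx₁ hx₂ (hr _ _ hx₁ hx₂ h.1)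
        (hr _ _ (val_y_le_one hW h₁.1 hx₁) (val_y_le_one hW h₂.1 hx₂) h.2)
  refine Finite.of_injective (fun q : W.toAffine.Point ⧸ kerReduction hW => Φ q.out) ?_
  intro q₁ q₂ h
  have := hΦ _ _ h.symm
  rw [← Quotient.out_eq' q₁, ← Quotient.out_eq' q₂]
  refine QuotientAddGroup.eq.mpr ?_
  rwa [neg_add_eq_sub]

end Smooth

/-! ### Coordinates z, w near the origin, Hensel lifting, and inverting p on the kernel. -/

section Limits

open WeierstrassCurve.Affine WithZero

variable {F : Type*} [Field F] {W : WeierstrassCurve F}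

/-- The equation of the curve in the coordinates `z = x / y`, `w = 1 / y`. -/
def zwPoly (W : WeierstrassCurve F) (z w : F) : F :=
  w + W.a₁ * z * w + W.a₃ * w ^ 2 - (z ^ 3 + W.a₂ * z ^ 2 * w + W.a₄ * z * w ^ 2 + W.a₆ * w ^ 3)

/-- The function `1 / y` on the points of a Weierstrass curve. -/
def wCoord : W.toAffine.Point → F
  | .zero => 0
  | .some _ y _ => y⁻¹

section

variable {Γ₀ : Type*} [LinearOrderedCommGroupWithZero Γ₀] {v : Valuation F Γ₀}

lemma zwPoly_zCoord (hW : IntegralCoeffs v W) {P : W.toAffine.Point} (hP : InKer v P) :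
    zwPoly W (zCoord P) (wCoord P) = 0 ∧ v (wCoord P) < 1 := by
  rcases P with _ | ⟨x, y, h⟩
  · change zwPoly W 0 0 = 0 ∧ v 0 < 1
    simp [zwPoly]
  · have hk := isKer_of_one_lt hW h.1 hP
    have hy := hk.y_ne
    have he := (W.toAffine.equation_iff x y).mp h.1
    constructor
    · change zwPoly W (x / y) y⁻¹ = 0
      rw [zwPoly]
      field_simp
      linear_combination he
    · change v y⁻¹ < 1
      rw [map_inv₀, hk.vy, inv_inv]
      exact pow_lt_one₀ zero_le hk.z_lt (by norm_num)

/-- Subtracting the two equations gives (w₁ - w₂) times a unit equal to (z₁ - z₂) times an integral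
element. Convergence of z-coordinates therefore forces convergence of w-coordinates. -/
lemma val_sub_le_of_zwPoly (hW : IntegralCoeffs v W) {z₁ w₁ z₂ w₂ : F} (h₁ : zwPoly W z₁ w₁ = 0)
    (h₂ : zwPoly W z₂ w₂ = 0) (hz₁ : v z₁ < 1) (hw₁ : v w₁ < 1) (hz₂ : v z₂ < 1) (hw₂ : v w₂ < 1) :
    v (w₁ - w₂) ≤ v (z₁ - z₂) := by
  obtain ⟨h1, h2, h3, h4, h6⟩ := hW
  have hz₁' := hz₁.le
  have hz₂' := hz₂.le
  have hw₁' := hw₁.le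
  have hw₂' := hw₂.le
  have key : (w₁ - w₂) * (1 + (z₂ * (W.a₁ - W.a₂ * z₂ - W.a₄ * (w₁ + w₂)) +
      w₁ * (W.a₃ - W.a₆ * (w₁ + w₂)) + w₂ * (W.a₃ - W.a₆ * w₂))) =
      (z₁ - z₂) * (z₁ ^ 2 + z₁ * z₂ + z₂ ^ 2 + W.a₂ * (z₁ + z₂) * w₁ + W.a₄ * w₁ ^ 2 - W.a₁ * w₁) := by
    simp only [zwPoly] at h₁ h₂
    linear_combination h₁ - h₂
  have h5 := congrArg v key
  rw [map_mul, vunit_one_add (v.map_add_lt (v.map_add_lt (vlt_mul hz₂ ?_) (vlt_mul hw₁ ?_))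
    (vlt_mul hw₂ ?_)), mul_one] at h5
  · rw [h5]
    exact vmul_le_left le_rfl (by apply_rules [vle_add, vle_sub, vle_mul, vle_pow])
  all_goals apply_rules [vle_add, vle_sub, vle_mul, vle_pow]

/-- The equation reads w · (unit) = z³, so w = 0 only at the origin, and otherwise x = z/w has
valuation v(z)⁻², which exceeds one. -/
lemma exists_inKer_of_zwPoly (hW : IntegralCoeffs v W) (hΔ : W.Δ ≠ 0) {z w : F}
    (h : zwPoly W z w = 0) (hz : v z < 1) (hw : v w < 1) :
    ∃ P : W.toAffine.Point, InKer v P ∧ zCoord P = z := by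
  obtain ⟨h1, h2, h3, h4, h6⟩ := hW
  have hz' := hz.le
  have hw' := hw.le
  have key : w * (1 + (z * (W.a₁ - W.a₂ * z - W.a₄ * w) + w * (W.a₃ - W.a₆ * w))) = z ^ 3 := by
    simp only [zwPoly] at h
    linear_combination h
  have hvw : v w = v z ^ 3 := by
    rw [← map_pow, ← key, map_mul, vunit_one_add (v.map_add_lt (vlt_mul hz ?_) (vlt_mul hw ?_)),
      mul_one]
    all_goals apply_rules [vle_add, vle_sub, vle_mul, vle_pow]
  by_cases hw0 : w = 0
  · refine ⟨0, trivial, ?_⟩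
    rw [hw0, map_zero] at hvw
    have : v z = 0 := by
      rcases eq_or_ne (v z) 0 with h0 | h0
      · exact h0
      · exact absurd hvw.symm (pow_ne_zero 3 h0)
    rw [zCoord_zero, (v.zero_iff).mp this]
  · have hz0 : z ≠ 0 := by
      rintro rfl
      simp [hw0] at hvw
    have he : W.toAffine.Equation (z / w) w⁻¹ := by
      rw [equation_iff]
      simp only [zwPoly] at h
      field_simp
      linear_combination h
    refine ⟨.some (z / w) w⁻¹ ((equation_iff_nonsingular_of_Δ_ne_zero hΔ).mp he), ?_, ?_⟩
    · rw [inKer_some, map_div₀, hvw, one_lt_div₀ (pow_pos (zero_lt_iff.mpr (v.ne_zero_iff.mpr hz0)) 3)]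
      calc v z ^ 3 < v z ^ 1 := pow_lt_pow_right_of_lt_one₀
            (zero_lt_iff.mpr (v.ne_zero_iff.mpr hz0)) hz (by norm_num)
        _ = v z := pow_one _
    · rw [zCoord_some]; field_simp

end

variable {v : Valuation F ℤᵐ⁰}

/-- Hensel's lemma: points of the reduction lift. -/
lemma exists_equation_of_congr (hv : HasLimits v) (hW : IntegralCoeffs v W) (hΔ : v W.Δ = 1)
    {x₀ y₀ : F} (hx : v x₀ ≤ 1) (hy : v y₀ ≤ 1) (h : v (y₀ ^ 2 + W.a₁ * x₀ * y₀ + W.a₃ * y₀ -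
      (x₀ ^ 3 + W.a₂ * x₀ ^ 2 + W.a₄ * x₀ + W.a₆)) < 1) :
    ∃ x y, W.toAffine.Equation x y ∧ v (x - x₀) < 1 ∧ v (y - y₀) < 1 := by
  -- Newton's method runs in whichever coordinate has a unit partial derivative, with the other
  -- coordinate held fixed.
  rcases val_partial_eq_one hW hΔ hx hy h with hd | hd
  · obtain ⟨x, hx1, hx2⟩ := exists_root_of_approx hv (f := fun x => (x ^ 3 + W.a₂ * x ^ 2 +
      W.a₄ * x + W.a₆) - (y₀ ^ 2 + W.a₁ * x * y₀ + W.a₃ * y₀)) hd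
      (by rwa [v.map_sub_swap]) (by
        intro x h hxx hh
        have hx' : v x ≤ 1 := by
          have := v.map_add_le hxx.le hx
          simpa using this
        have hh' := hh.le
        have key : (fun x => (x ^ 3 + W.a₂ * x ^ 2 + W.a₄ * x + W.a₆) -
            (y₀ ^ 2 + W.a₁ * x * y₀ + W.a₃ * y₀)) (x + h) - (fun x => (x ^ 3 + W.a₂ * x ^ 2 +
              W.a₄ * x + W.a₆) - (y₀ ^ 2 + W.a₁ * x * y₀ + W.a₃ * y₀)) x -
              (3 * x₀ ^ 2 + 2 * W.a₂ * x₀ + W.a₄ - W.a₁ * y₀) * h =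
            ((x - x₀) * (3 * (x + x₀) + 2 * W.a₂) + h * (3 * x + h + W.a₂)) * h := by
          ring
        rw [key]
        obtain ⟨h1, h2, h3, h4, h6⟩ := hW
        refine vmul_le (le_exp_neg_one (v.map_add_lt (vlt_mul hxx ?_) (vlt_mul hh ?_))) le_rfl
        all_goals apply_rules [vle_add, vle_mul, vle_ofNat])
    refine ⟨x, y₀, ?_, hx2, by simp⟩
    rw [equation_iff]
    exact (sub_eq_zero.mp hx1).symm
  · obtain ⟨y, hy1, hy2⟩ := exists_root_of_approx hv (f := fun y => (y ^ 2 + W.a₁ * x₀ * y +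
      W.a₃ * y) - (x₀ ^ 3 + W.a₂ * x₀ ^ 2 + W.a₄ * x₀ + W.a₆)) hd h (by
        intro y h hyy hh
        have key : (fun y => (y ^ 2 + W.a₁ * x₀ * y + W.a₃ * y) - (x₀ ^ 3 + W.a₂ * x₀ ^ 2 +
            W.a₄ * x₀ + W.a₆)) (y + h) - (fun y => (y ^ 2 + W.a₁ * x₀ * y + W.a₃ * y) -
              (x₀ ^ 3 + W.a₂ * x₀ ^ 2 + W.a₄ * x₀ + W.a₆)) y -
              (2 * y₀ + W.a₁ * x₀ + W.a₃) * h = ((y - y₀) * 2 + h) * h := by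
          ring
        rw [key]
        exact vmul_le (le_exp_neg_one (v.map_add_lt (vlt_mul hyy (vle_ofNat 2)) hh)) le_rfl)
    refine ⟨x₀, y, ?_, by simp, hy2⟩
    rw [equation_iff]
    exact sub_eq_zero.mp hy1

variable [DecidableEq F]

lemma exists_limit_inKer (hv : HasLimits v) (hW : IntegralCoeffs v W) (hΔ : W.Δ ≠ 0)
    {P : ℕ → W.toAffine.Point} (hP : ∀ n, InKer v (P n))
    (hPn : ∀ n, v (zCoord (P (n + 1) - P n)) ≤ exp (-(n : ℤ))) :
    ∃ Q, InKer v Q ∧ ∀ n, v (zCoord (Q - P n)) ≤ exp (-(n : ℤ)) := by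
  have hz : ∀ n, v (zCoord (P (n + 1)) - zCoord (P n)) ≤ exp (-(n : ℤ)) := fun n => by
    rw [← (inKer_sub hW (hP _) (hP _)).2]
    exact hPn n
  have hz1 := fun n => zCoord_lt_one hW (hP n)
  have hw1 := fun n => zwPoly_zCoord hW (hP n)
  obtain ⟨z, hzl⟩ := hv (fun n => zCoord (P n)) hz
  obtain ⟨w, hwl⟩ := hv (fun n => wCoord (P n)) fun n =>
    (val_sub_le_of_zwPoly hW (hw1 _).1 (hw1 _).1 (hz1 _) (hw1 _).2 (hz1 _) (hw1 _).2).trans (hz n)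
  have hlim : ∀ {l a : F}, v (l - a) ≤ exp (-((1 : ℕ) : ℤ)) → v a < 1 → v l < 1 := by
    intro l a hl ha
    have := v.map_add_lt (hl.trans_lt (by simpa using exp_neg_one_lt_one)) ha
    simpa using this
  have hz1' := hlim (hzl 1) (hz1 1)
  have hw1' := hlim (hwl 1) (hw1 1).2
  have h0 : zwPoly W z w = 0 := by
    rw [← v.zero_iff]
    refine eq_zero_of_forall_le_exp fun n => ?_
    obtain ⟨h1, h2, h3, h4, h6⟩ := hW
    have hzn := (hz1 n).le
    have hwn := (hw1 n).2.le
    have hz' := hz1'.le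
    have hw' := hw1'.le
    have h5 := (hw1 n).1
    have key : zwPoly W z w = (w - wCoord (P n)) * (1 + W.a₁ * z + W.a₃ * (w + wCoord (P n)) -
        W.a₂ * z ^ 2 - W.a₄ * z * (w + wCoord (P n)) -
          W.a₆ * (w ^ 2 + w * wCoord (P n) + wCoord (P n) ^ 2)) +
        (z - zCoord (P n)) * (W.a₁ * wCoord (P n) - (z ^ 2 + z * zCoord (P n) + zCoord (P n) ^ 2) -
          W.a₂ * (z + zCoord (P n)) * wCoord (P n) - W.a₄ * wCoord (P n) ^ 2) := by
      simp only [zwPoly] at h5 ⊢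
      linear_combination h5
    rw [key]
    exact v.map_add_le
      (vmul_le_left (hwl n) (by apply_rules [vle_add, vle_sub, vle_mul, vle_pow, vle_one]))
      (vmul_le_left (hzl n) (by apply_rules [vle_add, vle_sub, vle_mul, vle_pow, vle_one]))
  obtain ⟨Q, hQ, hQz⟩ := exists_inKer_of_zwPoly hW hΔ h0 hz1' hw1'
  refine ⟨Q, hQ, fun n => ?_⟩
  rw [(inKer_sub hW hQ (hP n)).2, hQz]
  exact hzl n

/-- Multiplication by an integer prime to the residue characteristic is bijective on the kernel of
reduction. -/
lemma kerReduction_bijective (hv : HasLimits v) (hW : IntegralCoeffs v W) (hΔ : W.Δ ≠ 0) {n p : ℕ}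
    (hn : v (n : F) < 1) (hnp : Nat.Coprime p n) :
    (∀ P ∈ kerReduction hW, p • P = 0 → P = 0) ∧
      ∀ P ∈ kerReduction hW, ∃ Q ∈ kerReduction hW, p • Q = P := by
  -- From ap + bn = 1, multiplication by ap is 1 - T with T = bn, and T moves the kernel one step
  -- down the filtration. If pP = 0 then P = T^k P for all k, so P = 0.
  obtain ⟨a, b, hab⟩ := Nat.isCoprime_iff_coprime.mpr hnp
  have hsplit : ∀ P : W.toAffine.Point, P = p • (a • P) + b • (n • P) := fun P => by
    conv_lhs => rw [← one_zsmul P, ← hab]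
    rw [add_zsmul, mul_comm a, mul_zsmul, mul_zsmul, natCast_zsmul, natCast_zsmul]
  have hT : ∀ (P : W.toAffine.Point) (k : ℕ), P ∈ kerFiltration hW (exp (-((k + 1 : ℕ) : ℤ))) →
      b • (n • P) ∈ kerFiltration hW (exp (-((k + 2 : ℕ) : ℤ))) := by
    intro P k hP
    refine AddSubgroup.zsmul_mem _ (mem_kerFiltration.mpr ⟨(AddSubgroup.nsmul_mem _ hP n).1, ?_⟩) b
    have h1 := val_zCoord_nsmul_le hW hP.1 (le_exp_neg_one hn)
      (le_exp_neg_one (zCoord_lt_one hW hP.1))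
    refine h1.trans ((mul_le_mul' le_rfl hP.2).trans ?_)
    rw [← exp_add, exp_le_exp]
    push_cast
    lia
  have hzero : ∀ P : W.toAffine.Point,
      (∀ k : ℕ, P ∈ kerFiltration hW (exp (-(k : ℤ)))) → P = 0 := fun P hP =>
    zCoord_eq_zero hW (hP 0).1 (v.zero_iff.mp (eq_zero_of_forall_le_exp fun k => (hP k).2))
  have hmono : ∀ (P : W.toAffine.Point) (k : ℕ), P ∈ kerFiltration hW (exp (-((k + 1 : ℕ) : ℤ))) →
      P ∈ kerFiltration hW (exp (-(k : ℤ))) := fun P k hP =>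
    ⟨hP.1, hP.2.trans (by rw [exp_le_exp]; push_cast; lia)⟩
  have hbase : ∀ P ∈ kerReduction hW, P ∈ kerFiltration hW (exp (-((0 + 1 : ℕ) : ℤ))) :=
    fun P hP => ⟨hP, by simpa using le_exp_neg_one (zCoord_lt_one hW hP)⟩
  refine ⟨fun P hP h0 => ?_, fun P hP => ?_⟩
  · have hfix : P = b • (n • P) := by
      have h1 := hsplit P
      rwa [smul_comm, h0, smul_zero, zero_add] at h1
    have hall : ∀ k : ℕ, P ∈ kerFiltration hW (exp (-((k + 1 : ℕ) : ℤ))) := by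
      intro k
      induction k with
      | zero => exact hbase P hP
      | succ k ih =>
        rw [hfix]
        exact hT P k ih
    exact hzero P fun k => hmono P k (hall k)
  -- Geometric series: `R k` is T^k P, and the partial sums `S k` of aT^i P satisfy P - p S_k = T^k
  -- P, which tends to 0.
  · let R : ℕ → W.toAffine.Point := fun k => Nat.rec P (fun _ S => b • (n • S)) k
    have hR : ∀ k, R (k + 1) = b • (n • R k) := fun k => rfl
    have hRk : ∀ k, R k ∈ kerFiltration hW (exp (-((k + 1 : ℕ) : ℤ))) := by
      intro k
      induction k with
      | zero => exact hbase P hP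
      | succ k ih =>
        rw [hR]
        exact hT _ k ih
    let S : ℕ → W.toAffine.Point := fun k => ∑ i ∈ Finset.range k, a • R i
    have hS : ∀ k, S (k + 1) = S k + a • R k := fun k => Finset.sum_range_succ _ _
    have hSk : ∀ k, S k ∈ kerReduction hW := fun k =>
      AddSubgroup.sum_mem _ fun i _ => AddSubgroup.zsmul_mem _ (hRk i).1 a
    have hPS : ∀ k, P - p • S k = R k := by
      intro k
      induction k with
      | zero => simp [S, R]
      | succ k ih =>
        rw [hS, smul_add, ← sub_sub, ih, hR]
        nth_rewrite 1 [hsplit (R k)]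
        rw [add_sub_cancel_left]
    obtain ⟨Q, hQ, hQl⟩ := exists_limit_inKer hv hW hΔ (P := S) hSk fun k => by
      rw [hS, add_sub_cancel_left]
      exact (AddSubgroup.zsmul_mem _ (hmono _ _ (hRk k)) a).2
    refine ⟨Q, hQ, ?_⟩
    rw [eq_comm, ← sub_eq_zero]
    refine hzero _ fun k => ?_
    have h1 : P - p • Q = R k - p • (Q - S k) := by
      rw [← hPS, smul_sub]; abel
    rw [h1]
    exact AddSubgroup.sub_mem _ (hmono _ _ (hRk k))
      (AddSubgroup.nsmul_mem _ (mem_kerFiltration.mpr ⟨(inKer_sub hW hQ (hSk k)).1, hQl k⟩) p)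

end Limits

/-! ### Transport of the group law along an admissible change of variables. -/

section VariableChange

open WeierstrassCurve WeierstrassCurve.Affine

variable {F : Type*} [Field F] (W : WeierstrassCurve F) (C : VariableChange F)

/-- The new `X`-coordinate under an admissible change of variables. -/
def vcX (x : F) : F := (C.u : F)⁻¹ ^ 2 * (x - C.r)

/-- The new `Y`-coordinate under an admissible change of variables. -/
def vcY (x y : F) : F := (C.u : F)⁻¹ ^ 3 * (y - C.s * (x - C.r) - C.t)

variable {W}

lemma vc_equation {x y : F} :
    (C • W).toAffine.Equation (vcX C x) (vcY C x y) ↔ W.toAffine.Equation x y := by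
  have hu : (C.u : F) ≠ 0 := C.u.ne_zero
  rw [equation_iff', equation_iff', variableChange_a₁, variableChange_a₂, variableChange_a₃,
    variableChange_a₄, variableChange_a₆, Units.val_inv_eq_inv_val]
  simp only [vcX, vcY]
  constructor
  · intro h
    linear_combination (norm := (field_simp; ring)) (C.u : F) ^ 6 * h
  · intro h
    linear_combination (norm := (field_simp; ring)) (C.u : F)⁻¹ ^ 6 * h

lemma vc_negY {x y : F} : (C • W).toAffine.negY (vcX C x) (vcY C x y) =
    vcY C x (W.toAffine.negY x y) := by
  have hu : (C.u : F) ≠ 0 := C.u.ne_zero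
  rw [negY, negY, variableChange_a₁, variableChange_a₃, Units.val_inv_eq_inv_val]
  simp only [vcX, vcY]
  field_simp
  ring

lemma vcX_inj {x₁ x₂ : F} : vcX C x₁ = vcX C x₂ ↔ x₁ = x₂ := by
  simp [vcX]

lemma vcY_inj {x y₁ y₂ : F} : vcY C x y₁ = vcY C x y₂ ↔ y₁ = y₂ := by
  simp [vcY]

/-- The third argument is the slope, in the new coordinates, of a line of slope ℓ; `vc_slope`
identifies it with the slope used by the group law. -/
lemma vc_addX {x₁ x₂ ℓ : F} :
    (C • W).toAffine.addX (vcX C x₁) (vcX C x₂) ((C.u : F)⁻¹ * (ℓ - C.s)) =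
      vcX C (W.toAffine.addX x₁ x₂ ℓ) := by
  have hu : (C.u : F) ≠ 0 := C.u.ne_zero
  rw [addX, addX, variableChange_a₁, variableChange_a₂, Units.val_inv_eq_inv_val]
  simp only [vcX]
  field_simp
  ring

lemma vc_addY {x₁ x₂ y₁ ℓ : F} :
    (C • W).toAffine.addY (vcX C x₁) (vcX C x₂) (vcY C x₁ y₁) ((C.u : F)⁻¹ * (ℓ - C.s)) =
      vcY C (W.toAffine.addX x₁ x₂ ℓ) (W.toAffine.addY x₁ x₂ y₁ ℓ) := by
  have hu : (C.u : F) ≠ 0 := C.u.ne_zero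
  rw [addY, addY, ← vc_negY, negAddY, vc_addX]
  congr 1
  simp only [negAddY, vcX, vcY]
  field_simp
  ring

variable [DecidableEq F]

lemma vc_slope {x₁ x₂ y₁ y₂ : F} (h₁ : W.toAffine.Equation x₁ y₁) (h₂ : W.toAffine.Equation x₂ y₂)
    (h : ¬(x₁ = x₂ ∧ y₁ = W.toAffine.negY x₂ y₂)) :
    (C • W).toAffine.slope (vcX C x₁) (vcX C x₂) (vcY C x₁ y₁) (vcY C x₂ y₂) =
      (C.u : F)⁻¹ * (W.toAffine.slope x₁ x₂ y₁ y₂ - C.s) := by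
  have hu : (C.u : F) ≠ 0 := C.u.ne_zero
  by_cases hx : x₁ = x₂
  · have hy : y₁ ≠ W.toAffine.negY x₂ y₂ := fun h' => h ⟨hx, h'⟩
    obtain rfl : y₁ = y₂ := Y_eq_of_Y_ne h₁ h₂ hx hy
    subst hx
    have hy' : vcY C x₁ y₁ ≠ (C • W).toAffine.negY (vcX C x₁) (vcY C x₁ y₁) := by
      rw [vc_negY, Ne, vcY_inj]
      exact hy
    rw [slope_of_Y_ne rfl hy, slope_of_Y_ne rfl hy', vc_negY]
    have hd : y₁ - W.toAffine.negY x₁ y₁ ≠ 0 := sub_ne_zero.mpr hy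
    have hd' : vcY C x₁ y₁ - vcY C x₁ (W.toAffine.negY x₁ y₁) =
        (C.u : F)⁻¹ ^ 3 * (y₁ - W.toAffine.negY x₁ y₁) := by
      simp only [vcY]; ring
    rw [hd', div_eq_iff (mul_ne_zero (pow_ne_zero _ (inv_ne_zero hu)) hd)]
    have h5 : (C.u : F)⁻¹ * ((3 * x₁ ^ 2 + 2 * W.a₂ * x₁ + W.a₄ - W.a₁ * y₁) /
        (y₁ - W.toAffine.negY x₁ y₁) - C.s) * ((C.u : F)⁻¹ ^ 3 * (y₁ - W.toAffine.negY x₁ y₁)) =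
        (C.u : F)⁻¹ ^ 4 * ((3 * x₁ ^ 2 + 2 * W.a₂ * x₁ + W.a₄ - W.a₁ * y₁) -
          C.s * (y₁ - W.toAffine.negY x₁ y₁)) := by
      field_simp
    rw [h5, variableChange_a₁, variableChange_a₂, variableChange_a₄, Units.val_inv_eq_inv_val, negY]
    simp only [vcX, vcY]
    field_simp
    ring
  · rw [slope_of_X_ne hx, slope_of_X_ne (by rwa [Ne, vcX_inj])]
    have hd : x₁ - x₂ ≠ 0 := sub_ne_zero.mpr hx
    have hd' : vcX C x₁ - vcX C x₂ = (C.u : F)⁻¹ ^ 2 * (x₁ - x₂) := by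
      simp only [vcX]; ring
    rw [hd']
    simp only [vcY]
    field_simp
    ring

/-- The homomorphism on the groups of points given by an admissible change of variables. -/
def vcHom (hΔ : W.Δ ≠ 0) : W.toAffine.Point →+ (C • W).toAffine.Point where
  toFun P := match P with
    | .zero => .zero
    | .some x y h => .some (vcX C x) (vcY C x y) ((equation_iff_nonsingular_of_Δ_ne_zero (by
        rw [variableChange_Δ]
        exact mul_ne_zero (pow_ne_zero _ (Units.ne_zero _)) hΔ)).mp ((vc_equation C).mpr h.1))
  map_zero' := rfl
  map_add' := by
    rintro (_ | ⟨x₁, y₁, h₁⟩) (_ | ⟨x₂, y₂, h₂⟩)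
    any_goals rfl
    by_cases hxy : x₁ = x₂ ∧ y₁ = W.toAffine.negY x₂ y₂
    · rw [Point.add_of_Y_eq hxy.1 hxy.2, Point.add_of_Y_eq (by rw [hxy.1])
        (by rw [hxy.1, hxy.2, vc_negY])]
      rfl
    · rw [Point.add_some hxy, Point.add_some (fun h => hxy ?_)]
      · simp only [vc_slope C h₁.1 h₂.1 hxy, vc_addX, vc_addY]
      · have hx := (vcX_inj C).mp h.1
        refine ⟨hx, ?_⟩
        have hy := h.2
        rwa [vc_negY, hx, vcY_inj] at hy

lemma vcHom_some (hΔ : W.Δ ≠ 0) {x y : F} (h : W.toAffine.Nonsingular x y) :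
    ∃ h', vcHom C hΔ (.some x y h) = .some (vcX C x) (vcY C x y) h' := ⟨_, rfl⟩

lemma vcHom_injective (hΔ : W.Δ ≠ 0) : Function.Injective (vcHom C hΔ) := by
  refine (injective_iff_map_eq_zero _).mpr ?_
  rintro (_ | ⟨x, y, h⟩) h0
  · rfl
  · obtain ⟨h', h1⟩ := vcHom_some C hΔ h
    rw [h1] at h0
    exact absurd h0 (Point.some_ne_zero _)

lemma vcHom_exists_some (hΔ : W.Δ ≠ 0) {X Y : F} (h : (C • W).toAffine.Equation X Y) :
    ∃ x y h' h'', vcX C x = X ∧ vcY C x y = Y ∧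
      vcHom C hΔ (.some x y h') = .some X Y h'' := by
  have hu : (C.u : F) ≠ 0 := C.u.ne_zero
  have hX : vcX C (C.u ^ 2 * X + C.r) = X := by
    simp only [vcX]; field_simp; ring
  have hY : vcY C (C.u ^ 2 * X + C.r) (C.u ^ 3 * Y + C.s * (C.u ^ 2 * X) + C.t) = Y := by
    simp only [vcY]; field_simp; ring
  have he := (vc_equation (W := W) C (x := C.u ^ 2 * X + C.r)
    (y := C.u ^ 3 * Y + C.s * (C.u ^ 2 * X) + C.t)).mp (by rwa [hX, hY])
  obtain ⟨h', h1⟩ := vcHom_some C hΔ ((equation_iff_nonsingular_of_Δ_ne_zero hΔ).mp he)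
  simp only [hX, hY] at h1 h'
  exact ⟨_, _, _, h', hX, hY, h1⟩

lemma vcHom_surjective (hΔ : W.Δ ≠ 0) : Function.Surjective (vcHom C hΔ) := by
  rintro (_ | ⟨X, Y, h⟩)
  · exact ⟨0, rfl⟩
  · obtain ⟨x, y, h', h'', -, -, h1⟩ := vcHom_exists_some C hΔ h.1
    exact ⟨_, h1⟩

end VariableChange

/-! ### Limits and residue classes in the completion at a prime. -/

section AdicCompletion

open WithZero HeightOneSpectrum Filter Topology

variable {R : Type*} [CommRing R] [IsDedekindDomain R] {K : Type*} [Field K] [Algebra R K]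
  [IsFractionRing R K] (v : HeightOneSpectrum R)

lemma ball_mem_nhds {γ : ℤᵐ⁰} (hγ : γ ≠ 0) (a : v.adicCompletion K) :
    {x : v.adicCompletion K | Valued.v (x - a) < γ} ∈ 𝓝 a := by
  obtain ⟨π, rfl⟩ := valuedAdicCompletion_surjective K v γ
  rw [Valued.mem_nhds]
  refine ⟨Units.mk0 (Valued.v.restrict π) ?_, fun x hx => ?_⟩
  · rw [Ne, Valuation.zero_iff]
    rintro rfl
    simp at hγ
  · exact (Valuation.restrict_lt_iff _).mp hx

/-- The uniformity is described by radii in the value group of the valuation. This converts such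
radii into the explicit scale exp(-n). -/
lemma exists_embedding_eq (γ : (MonoidWithZeroHom.ValueGroup₀
    (.ofClass (Valued.v : Valuation (v.adicCompletion K) ℤᵐ⁰)))ˣ) :
    ∃ n : ℕ, ∀ x : v.adicCompletion K, Valued.v x ≤ exp (-(n : ℤ)) →
      Valued.v.restrict x < (γ : MonoidWithZeroHom.ValueGroup₀ _) := by
  set δ : ℤᵐ⁰ := MonoidWithZeroHom.ValueGroup₀.embedding
    (γ : MonoidWithZeroHom.ValueGroup₀ (.ofClass (Valued.v : Valuation (v.adicCompletion K) ℤᵐ⁰)))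
    with hδ
  have hδ0 : δ ≠ 0 := by
    rw [hδ]
    exact (map_ne_zero _).mpr γ.ne_zero
  refine ⟨(-log δ).toNat + 1, fun x hx => ?_⟩
  rw [Valuation.restrict_lt_iff_lt_embedding]
  refine hx.trans_lt ?_
  change _ < δ
  rw [← exp_log hδ0, exp_lt_exp, log_exp]
  push_cast
  lia

lemma hasLimits_adicCompletion : HasLimits (Valued.v : Valuation (v.adicCompletion K) ℤᵐ⁰) := by
  intro x hx
  have hle : ∀ n m : ℕ, n ≤ m → Valued.v (x m - x n) ≤ exp (-(n : ℤ)) := by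
    intro n m h
    induction m, h using Nat.le_induction with
    | base => simp
    | succ m hm ih =>
      rw [← sub_add_sub_cancel (x (m + 1)) (x m) (x n)]
      refine Valuation.map_add_le _ ((hx m).trans ?_) ih
      rw [exp_le_exp]
      lia
  have hc : CauchySeq x := by
    refine Valued.cauchy_iff.mpr ⟨inferInstance, fun γ => ?_⟩
    obtain ⟨n, hn⟩ := exists_embedding_eq v γ
    refine ⟨x '' Set.Ici n, image_mem_map (mem_atTop n), ?_⟩
    rintro _ ⟨i, hi, rfl⟩ _ ⟨j, hj, rfl⟩
    refine hn _ ?_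
    rw [← sub_sub_sub_cancel_right _ _ (x n)]
    exact Valuation.map_sub_le _ (hle n j hj) (hle n i hi)
  obtain ⟨l, hl⟩ := cauchySeq_tendsto_of_complete hc
  refine ⟨l, fun n => ?_⟩
  obtain ⟨m, hm⟩ := ((hl.eventually (ball_mem_nhds v (exp_ne_zero (a := -(n : ℤ))) l)).and
    (eventually_ge_atTop n)).exists
  rw [← sub_add_sub_cancel l (x m) (x n)]
  refine Valuation.map_add_le _ ?_ (hle n m hm.2)
  rw [Valuation.map_sub_swap]
  exact (show Valued.v (x m - l) < exp (-(n : ℤ)) from hm.1).le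

/-- By density x is close to some k in K, which is then v-integral, and k is congruent to an element
of R. Thus completing does not enlarge the residue field. -/
lemma exists_sub_lt_one {x : v.adicCompletion K} (hx : Valued.v x ≤ 1) :
    ∃ r : R, Valued.v (x - algebraMap R (v.adicCompletion K) r) < 1 := by
  obtain ⟨k, hk⟩ := (v.denseRange_algebraMap K).exists_mem_open isOpen_interior
    ⟨x, mem_interior_iff_mem_nhds.mpr (ball_mem_nhds v one_ne_zero x)⟩
  have hk0 := interior_subset hk
  have hk' : Valued.v (algebraMap K (v.adicCompletion K) k - x) < 1 := hk0
  have hv : ∀ k : K, Valued.v (algebraMap K (v.adicCompletion K) k) = v.valuation K k :=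
    fun k => adicCompletion.valued_coe K v k
  have hk1 : v.valuation K k ≤ 1 := by
    rw [← hv]
    have := Valuation.map_add_le Valued.v hk'.le hx
    rwa [sub_add_cancel] at this
  obtain ⟨r, hr⟩ := v.exists_valuation_sub_lt_of_integer hk1 1
  refine ⟨r, ?_⟩
  rw [Units.val_one, ← hv, map_sub, ← IsScalarTower.algebraMap_apply] at hr
  rw [Valuation.map_sub_swap] at hk' hr
  have := Valuation.map_add_lt Valued.v hk' hr
  rwa [sub_add_sub_cancel] at this

lemma valued_algebraMap_lt_one_iff (r : R) :
    Valued.v (algebraMap R (v.adicCompletion K) r) < 1 ↔ r ∈ v.asIdeal := by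
  rw [IsScalarTower.algebraMap_apply R K, ← v.valuation_lt_one_iff_mem (K := K)]
  exact Iff.of_eq (congrArg (· < 1) (adicCompletion.valued_coe K v _))

variable (K) in
/-- A residue map on the integers of the completion. -/
lemma exists_residue_map : ∃ r : v.adicCompletion K → R ⧸ v.asIdeal, ∀ x y, Valued.v x ≤ 1 →
    Valued.v y ≤ 1 → r x = r y → Valued.v (x - y) < 1 := by
  classical
  refine ⟨fun x => if h : Valued.v x ≤ 1 then
    Ideal.Quotient.mk _ (exists_sub_lt_one v h).choose else 0, fun x y hx hy h => ?_⟩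
  simp only [dif_pos hx, dif_pos hy] at h
  have hx' := (exists_sub_lt_one v hx).choose_spec
  have hy' := (exists_sub_lt_one v hy).choose_spec
  set a := (exists_sub_lt_one v hx).choose
  set b := (exists_sub_lt_one v hy).choose
  have hab := (valued_algebraMap_lt_one_iff (K := K) v _).mpr (Ideal.Quotient.eq.mp h)
  rw [map_sub] at hab
  rw [Valuation.map_sub_swap] at hy'
  have := Valuation.map_add_lt Valued.v (Valuation.map_add_lt Valued.v hx' hab) hy'
  rwa [sub_add_sub_cancel, sub_add_sub_cancel] at this

end AdicCompletion

/-! ### The extension of completions: integrality and the Galois property. -/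

section Extension

open WithZero HeightOneSpectrum Filter Topology

variable {K L : Type u} [Field K] [NumberField K] [Field L] [NumberField L] [Algebra K L]
  (v : HeightOneSpectrum (𝓞 K)) (w : HeightOneSpectrum (𝓞 L)) [w.asIdeal.LiesOver v.asIdeal]

lemma continuous_completionMap : Continuous (completionMap v w) :=
  (adicCompletion.continuous_ofCompletion L w).comp
    (UniformSpace.Completion.continuous_map.comp (adicCompletion.continuous_toCompletion K v))

instance : ContinuousSMul (v.adicCompletion K) (w.adicCompletion L) where
  continuous_smul := by
    have : (fun p : v.adicCompletion K × w.adicCompletion L => p.1 • p.2) =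
        fun p => completionMap v w p.1 * p.2 := by
      ext1 p
      exact Algebra.smul_def _ _
    rw [this]
    exact ((continuous_completionMap v w).comp continuous_fst).mul continuous_snd

lemma algebraMap_tower (k : K) : algebraMap (v.adicCompletion K) (w.adicCompletion L)
    (algebraMap K (v.adicCompletion K) k) =
      algebraMap L (w.adicCompletion L) (algebraMap K L k) := by
  rw [← IsScalarTower.algebraMap_apply, ← IsScalarTower.algebraMap_apply]

/-- The embedding `K_v → L_w` respects integrality. -/
lemma valued_algebraMap_le_lt (x : v.adicCompletion K) :
    (Valued.v x ≤ 1 → Valued.v (algebraMap (v.adicCompletion K) (w.adicCompletion L) x) ≤ 1) ∧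
      (Valued.v x < 1 → Valued.v (algebraMap (v.adicCompletion K) (w.adicCompletion L) x) < 1) := by
  -- An element k of K is chosen close to x in K_v whose image is also close to that of x in L_w.
  -- For k itself the two valuations differ by the ramification exponent, which is nonzero.
  have hnhds : {y | Valued.v (y - x) < 1 ∧ Valued.v (algebraMap (v.adicCompletion K)
      (w.adicCompletion L) y - algebraMap (v.adicCompletion K) (w.adicCompletion L) x) < 1} ∈ 𝓝 x :=
    Filter.inter_mem (ball_mem_nhds v one_ne_zero x)
      ((continuous_completionMap v w).continuousAt (ball_mem_nhds w one_ne_zero _))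
  obtain ⟨k, hk⟩ := (v.denseRange_algebraMap K).exists_mem_open isOpen_interior
    ⟨x, mem_interior_iff_mem_nhds.mpr hnhds⟩
  have hk' := interior_subset hk
  obtain ⟨hk1, hk2⟩ : Valued.v (algebraMap K (v.adicCompletion K) k - x) < 1 ∧ Valued.v
    (algebraMap (v.adicCompletion K) (w.adicCompletion L) (algebraMap K (v.adicCompletion K) k) -
      algebraMap (v.adicCompletion K) (w.adicCompletion L) x) < 1 := hk'
  have hv : Valued.v (algebraMap K (v.adicCompletion K) k) = v.valuation K k :=
    adicCompletion.valued_coe K v k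
  have hw : Valued.v (algebraMap (v.adicCompletion K) (w.adicCompletion L)
      (algebraMap K (v.adicCompletion K) k)) =
      v.valuation K k ^ v.asIdeal.ramificationIdx' w.asIdeal := by
    rw [algebraMap_tower, valuation_liesOver (K := K) L v w]
    exact adicCompletion.valued_coe L w _
  have he : v.asIdeal.ramificationIdx' w.asIdeal ≠ 0 :=
    Ideal.IsDedekindDomain.ramificationIdx'_ne_zero_of_liesOver w.asIdeal v.ne_bot
  rw [Valuation.map_sub_swap] at hk2
  constructor
  · intro hx
    have h1 := Valuation.map_add_le Valued.v hk1.le hx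
    rw [sub_add_cancel, hv] at h1
    have h2 := Valuation.map_add_le Valued.v hk2.le (hw.le.trans (pow_le_one' h1 _))
    rwa [sub_add_cancel] at h2
  · intro hx
    have h1 := Valuation.map_add_lt Valued.v hk1 hx
    rw [sub_add_cancel, hv] at h1
    have h2 := Valuation.map_add_lt Valued.v hk2 (hw.le.trans_lt (pow_lt_one₀ zero_le h1 he))
    rwa [sub_add_cancel] at h2

lemma valued_algebraMap_eq_one {x : v.adicCompletion K} (hx : Valued.v x = 1) :
    Valued.v (algebraMap (v.adicCompletion K) (w.adicCompletion L) x) = 1 := by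
  refine le_antisymm ((valued_algebraMap_le_lt v w x).1 hx.le) ?_
  have h := (valued_algebraMap_le_lt v w x⁻¹).1 (by rw [map_inv₀, hx, inv_one])
  have h0 : x ≠ 0 := by
    rintro rfl
    simp at hx
  rw [map_inv₀, map_inv₀] at h
  exact (inv_le_one₀ (zero_lt_iff.mpr (by simpa using h0))).mp h

-- The image of K_v ⊗ L is a finite-dimensional K_v-subspace of L_w, hence closed, and it is dense
-- because it contains L.
open NumberField NumberField.HeightOneSpectrum in
open scoped Valued in
lemma lift_surjective : Function.Surjective
    (Algebra.TensorProduct.lift (Algebra.algHom (v.adicCompletion K) (v.adicCompletion K)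
      (w.adicCompletion L)) (Algebra.algHom K L (w.adicCompletion L))
      (fun _ _ ↦ mul_comm ..)).toLinearMap := by
  set Φ := (Algebra.TensorProduct.lift (Algebra.algHom (v.adicCompletion K) (v.adicCompletion K)
      (w.adicCompletion L)) (Algebra.algHom K L (w.adicCompletion L))
      (fun _ _ ↦ mul_comm ..)).toLinearMap with hΦ
  have h_dense : DenseRange Φ := by
    apply (w.denseRange_algebraMap L).mono
    rintro _ ⟨l, rfl⟩
    exact ⟨1 ⊗ₜ l, by simp [Φ, Algebra.algHom]⟩
  rw [← Set.range_eq_univ, ← Φ.coe_range, ← Φ.range.closed_of_finiteDimensional.closure_eq]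
  exact h_dense.closure_range

lemma adjoin_range_eq_top : Algebra.adjoin (v.adicCompletion K)
    (Set.range (algebraMap L (w.adicCompletion L))) = ⊤ := by
  refine eq_top_iff.mpr fun x _ => ?_
  obtain ⟨t, rfl⟩ := lift_surjective v w x
  induction t with
  | zero => rw [map_zero]; exact zero_mem _
  | add a b ha hb => rw [map_add]; exact add_mem (ha trivial) (hb trivial)
  | tmul a b =>
    have : (Algebra.TensorProduct.lift (Algebra.algHom (v.adicCompletion K) (v.adicCompletion K)
      (w.adicCompletion L)) (Algebra.algHom K L (w.adicCompletion L))
      (fun _ _ ↦ mul_comm ..)).toLinearMap (a ⊗ₜ b) =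
        algebraMap _ (w.adicCompletion L) a * algebraMap L (w.adicCompletion L) b := rfl
    rw [this]
    exact mul_mem (Subalgebra.algebraMap_mem _ _) (Algebra.subset_adjoin ⟨b, rfl⟩)

/-- The completion of a Galois extension is Galois. -/
lemma isGalois_adicCompletion [IsGalois K L] :
    IsGalois (v.adicCompletion K) (w.adicCompletion L) := by
  -- L_w is generated over K_v by L, so it is a splitting field over K_v of the same polynomial f;
  -- separability is automatic in characteristic zero.
  obtain ⟨f, hf⟩ := Normal.exists_isSplittingField K L
  have : CharZero (v.adicCompletion K) :=
    charZero_of_injective_algebraMap (algebraMap K (v.adicCompletion K)).injective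
  have hmap : (f.map (algebraMap K (v.adicCompletion K))).map
      (algebraMap (v.adicCompletion K) (w.adicCompletion L)) =
      (f.map (algebraMap K L)).map (algebraMap L (w.adicCompletion L)) := by
    rw [Polynomial.map_map, Polynomial.map_map, ← IsScalarTower.algebraMap_eq,
      ← IsScalarTower.algebraMap_eq]
  have hsplit : Polynomial.IsSplittingField (v.adicCompletion K) (w.adicCompletion L)
      (f.map (algebraMap K (v.adicCompletion K))) := by
    refine ⟨?_, ?_⟩
    · rw [hmap]
      exact hf.splits'.map _
    · rw [eq_top_iff, ← adjoin_range_eq_top v w, Algebra.adjoin_le_iff]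
      rintro _ ⟨b, rfl⟩
      have hb : b ∈ Algebra.adjoin K (f.rootSet L) := by
        rw [hf.adjoin_rootSet']
        trivial
      induction hb using Algebra.adjoin_induction with
      | mem a ha =>
        apply Algebra.subset_adjoin
        rw [Polynomial.mem_rootSet'] at ha ⊢
        refine ⟨?_, ?_⟩
        · rw [hmap]
          exact (Polynomial.map_ne_zero_iff (algebraMap L (w.adicCompletion L)).injective).mpr ha.1
        · rw [Polynomial.aeval_map_algebraMap, Polynomial.aeval_algebraMap_apply, ha.2, map_zero]
      | algebraMap r =>
        rw [← algebraMap_tower v w]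
        exact Subalgebra.algebraMap_mem _ _
      | add a b _ _ ha hb => rw [map_add]; exact add_mem ha hb
      | mul a b _ _ ha hb => rw [map_mul]; exact mul_mem ha hb
  have := Normal.of_isSplittingField (F := v.adicCompletion K) (E := w.adicCompletion L)
    (f.map (algebraMap K (v.adicCompletion K)))
  exact ⟨⟩

end Extension

/-! ### The image of the norm, as a statement about abelian groups. -/

section NormImage

variable {A B : Type*} [AddCommGroup A] [AddCommGroup B]

/-- `p` is invertible on the subgroup `H`. -/
structure BijectiveOn (p : ℕ) (H : AddSubgroup A) : Prop where
  eq_zero : ∀ P ∈ H, p • P = 0 → P = 0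
  exists_eq : ∀ P ∈ H, ∃ Q ∈ H, p • Q = P

namespace BijectiveOn

variable {p : ℕ} {H : AddSubgroup A}


lemma eq_zero_of_pow (h : BijectiveOn p H) (k : ℕ) {P : A} (hP : P ∈ H) (h0 : p ^ k • P = 0) : P = 0 := by
  induction k with
  | zero => simpa using h0
  | succ k ih =>
    refine ih (h.eq_zero _ (H.nsmul_mem hP _) ?_)
    rwa [← mul_nsmul, ← pow_succ]

lemma exists_pow (h : BijectiveOn p H) (k : ℕ) {P : A} (hP : P ∈ H) : ∃ Q ∈ H, p ^ k • Q = P := by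
  induction k with
  | zero => exact ⟨P, hP, by simp⟩
  | succ k ih =>
    obtain ⟨Q, hQ, rfl⟩ := ih
    obtain ⟨Q', hQ', rfl⟩ := h.exists_eq Q hQ
    exact ⟨Q', hQ', by rw [pow_succ, mul_nsmul, smul_comm]⟩

end BijectiveOn

lemma exists_eq_pow_mul_index {p : ℕ} (hp : p.Prime) (H : AddSubgroup A) [Finite (A ⧸ H)] :
    ∃ k m : ℕ, k ≠ 0 ∧ Nat.Coprime m p ∧ ∀ P : A, (p ^ k * m) • P ∈ H := by
  obtain ⟨e, m, hm, he⟩ := Nat.exists_eq_pow_mul_and_not_dvd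
    (AddSubgroup.index_ne_zero_of_finite (H := H)) p hp.one_lt.ne'
  -- One more factor p than the index contains ensures k ≠ 0, which is needed later for p^k M ⊆ pM
  -- and M[p] ⊆ M[p^k].
  refine ⟨e + 1, m, e.succ_ne_zero, ((Nat.Prime.coprime_iff_not_dvd hp).mpr hm).symm, fun P => ?_⟩
  rw [show p ^ (e + 1) * m = H.index * p by rw [he]; ring, mul_nsmul]
  exact H.nsmul_mem (H.nsmul_index_mem P) p

lemma eq_zero_of_coprime {a b : ℕ} (hab : Nat.Coprime a b) {P : A} (ha : a • P = 0)
    (hb : b • P = 0) : P = 0 := by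
  rw [← addOrderOf_dvd_iff_nsmul_eq_zero] at ha hb
  exact AddMonoid.addOrderOf_eq_one_iff.mp (Nat.eq_one_of_dvd_coprimes hab ha hb)

lemma exists_nsmul_of_coprime {a b : ℕ} (hab : Nat.Coprime a b) {P Q : A} (h : a • P = b • Q) :
    ∃ R, P = b • R := by
  obtain ⟨x, y, hxy⟩ := Nat.isCoprime_iff_coprime.mpr hab
  refine ⟨x • Q + y • P, ?_⟩
  calc P = (x * (a : ℤ) + y * b) • P := by rw [hxy, one_smul]
    _ = x • (a • P) + b • (y • P) := by
      rw [add_smul, mul_smul, natCast_zsmul, mul_comm y, mul_smul, natCast_zsmul]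
    _ = b • (x • Q + y • P) := by rw [h, smul_comm x b Q, smul_add]

/-- A norm map which is multiplication by `p` up to a subgroup on which `p` is invertible has image
`pA` on `A`. -/
theorem exists_eq_map_iff_exists_nsmul {p : ℕ} (hp : p.Prime) (inc : A →+ B)
    (hinc : Function.Injective inc) (N : B →+ B) (hN : ∀ a, N (inc a) = p • inc a)
    (A₁ : AddSubgroup A) (B₁ : AddSubgroup B) [Finite (A ⧸ A₁)] [Finite (B ⧸ B₁)]
    (hA : BijectiveOn p A₁) (hB : BijectiveOn p B₁) (hsum : ∀ b, ∃ a, b - inc a ∈ B₁) (a : A) :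
    (∃ b, inc a = N b) ↔ ∃ r, a = p • r := by
  constructor
  · rintro ⟨b, hb⟩
    obtain ⟨r, hr⟩ := hsum b
    set s := b - inc r
    obtain ⟨k, m, -, hm, hk⟩ := exists_eq_pow_mul_index hp A₁
    obtain ⟨l, n, -, hn, hl⟩ := exists_eq_pow_mul_index hp B₁
    set q := a - p • r with hq
    have hqs : inc q = N s := by
      rw [hq, map_sub, map_sub, hN, hb, map_nsmul]
    obtain ⟨a₁, ha₁, ha₁k⟩ := hA.exists_pow k (hk q)
    have ht : p ^ k • (m • q - a₁) = 0 := by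
      rw [smul_sub, ha₁k, mul_comm, mul_nsmul, sub_self]
    obtain ⟨a₂, -, ha₂⟩ := hA.exists_pow l ha₁
    obtain ⟨s₂, -, hs₂⟩ := hB.exists_pow l (B₁.nsmul_mem hr m)
    -- The p^k-torsion element m q - a₁ is divisible by p^l in B, so n times it lies in `B₁`, where
    -- p^k is injective; hence it vanishes. Neither N(B₁) ⊆ B₁ nor inc(A₁) ⊆ B₁ is required.
    have hc : inc (m • q - a₁) = p ^ l • (N s₂ - inc a₂) := by
      rw [map_sub, map_nsmul, hqs, ← map_nsmul, ← hs₂, ← ha₂, map_nsmul, map_nsmul, smul_sub]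
    have h1 : p ^ k • inc (m • q - a₁) = 0 := by rw [← map_nsmul, ht, map_zero]
    have h2 : n • inc (m • q - a₁) = 0 := by
      refine hB.eq_zero_of_pow k ?_ ?_
      · rw [hc, ← mul_nsmul]
        exact hl _
      · rw [smul_comm, h1, smul_zero]
    have h3 : inc (m • q - a₁) = 0 := eq_zero_of_coprime (hn.pow_right k) h2 h1
    have h4 : m • q = a₁ := sub_eq_zero.mp ((map_eq_zero_iff inc hinc).mp h3)
    obtain ⟨a₃, -, ha₃⟩ := hA.exists_eq a₁ ha₁
    obtain ⟨x, hx⟩ := exists_nsmul_of_coprime hm (h4.trans ha₃.symm)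
    exact ⟨x + r, by rw [smul_add, ← hx, hq, sub_add_cancel]⟩
  · rintro ⟨r, rfl⟩
    exact ⟨inc r, by rw [hN, map_nsmul]⟩

end NormImage

/-! ### Comparing the ranks of M/pM and M[p] over a Dedekind domain. -/

section Rank

variable {O : Type*} [CommRing O] {M : Type*} [AddCommGroup M] [Module O M]

/-- For a finite module with nonzero annihilator over a Dedekind domain, `M / 𝔭M` and `M[𝔭]` have
the same order. -/
lemma card_quotient_smul_top [IsDedekindDomain O] [Finite M] (𝔭 : Ideal O) {a : O} (ha : a ∈ 𝔭)
    (ha0 : a ≠ 0) (haM : ∀ m : M, a • m = 0) :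
    Nat.card (M ⧸ (𝔭 • ⊤ : Submodule O M)) = Nat.card (Submodule.torsionBySet O M (𝔭 : Set O)) := by
  -- Here 𝔭 = (a, π). As a kills M, the quotient M/𝔭M and the torsion M[𝔭] are the cokernel and
  -- kernel of multiplication by π on a finite group.
  obtain ⟨π, hπ⟩ := IsDedekindDomain.exists_sup_span_eq
    ((Ideal.span_singleton_le_iff_mem 𝔭).mpr ha) (by simpa using ha0)
  set f : M →ₗ[O] M := LinearMap.lsmul O M π with hf
  have haz : Ideal.span {a} • (⊤ : Submodule O M) = ⊥ := by
    rw [eq_bot_iff, Submodule.smul_le]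
    intro r hr m _
    obtain ⟨c, rfl⟩ := Ideal.mem_span_singleton'.mp hr
    rw [mul_smul, haM, smul_zero]
    exact zero_mem _
  have hrange : (𝔭 • ⊤ : Submodule O M) = f.range := by
    rw [← hπ, Submodule.sup_smul, haz, bot_sup_eq, Submodule.ideal_span_singleton_smul]
    ext m
    simp [Submodule.mem_smul_pointwise_iff_exists, hf]
  have hker : Submodule.torsionBySet O M (𝔭 : Set O) = f.ker := by
    ext m
    rw [Submodule.mem_torsionBySet_iff, LinearMap.mem_ker, hf, LinearMap.lsmul_apply]
    constructor
    · intro h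
      exact h ⟨π, hπ.le (Ideal.mem_sup_right (Ideal.mem_span_singleton_self π))⟩
    · rintro h ⟨r, hr⟩
      rw [← hπ] at hr
      obtain ⟨x, hx, y, hy, rfl⟩ := Submodule.mem_sup.mp hr
      obtain ⟨c, rfl⟩ := Ideal.mem_span_singleton'.mp hx
      obtain ⟨d, rfl⟩ := Ideal.mem_span_singleton'.mp hy
      change (c * a + d * π) • m = 0
      rw [add_smul, mul_smul, mul_smul, haM, h, smul_zero, smul_zero, add_zero]
  rw [hrange, hker]
  have h1 := Submodule.card_eq_card_quotient_mul_card f.range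
  have h2 := Submodule.card_eq_card_quotient_mul_card f.ker
  rw [Nat.card_congr f.quotKerEquivRange.toEquiv] at h2
  have h3 : Nat.card f.range ≠ 0 := Nat.card_pos.ne'
  rw [h1, mul_comm (Nat.card f.ker)] at h2
  exact Nat.eq_of_mul_eq_mul_left (Nat.pos_of_ne_zero h3) h2

lemma card_torsionBySet_of_le {s : Set O} {S : Submodule O M}
    (h : Submodule.torsionBySet O M s ≤ S) :
    Nat.card (Submodule.torsionBySet O S s) = Nat.card (Submodule.torsionBySet O M s) := by
  refine Nat.card_congr ((Equiv.ofBijective (fun x => ⟨x.1.1, ?_⟩) ⟨?_, ?_⟩))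
  · have := (Submodule.mem_torsionBySet_iff s x.1).mp x.2
    rw [Submodule.mem_torsionBySet_iff]
    intro a
    have h := congrArg Subtype.val (this a)
    simpa using h
  · intro x y hxy
    exact Subtype.ext (Subtype.ext (Subtype.mk.inj hxy))
  · rintro ⟨x, hx⟩
    refine ⟨⟨⟨x, h hx⟩, ?_⟩, rfl⟩
    rw [Submodule.mem_torsionBySet_iff] at hx ⊢
    intro a
    exact Subtype.ext (hx a)

lemma finrank_tensor_eq_of_card {M' : Type*} [AddCommGroup M'] [Module O M'] (𝔭 : Ideal O)
    [𝔭.IsMaximal] [Finite (O ⧸ 𝔭)] [Finite (M ⧸ (𝔭 • ⊤ : Submodule O M))]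
    [Finite (M' ⧸ (𝔭 • ⊤ : Submodule O M'))]
    (h : Nat.card (M ⧸ (𝔭 • ⊤ : Submodule O M)) = Nat.card (M' ⧸ (𝔭 • ⊤ : Submodule O M'))) :
    Module.finrank (O ⧸ 𝔭) ((O ⧸ 𝔭) ⊗[O] M) = Module.finrank (O ⧸ 𝔭) ((O ⧸ 𝔭) ⊗[O] M') := by
  let : Field (O ⧸ 𝔭) := Ideal.Quotient.field 𝔭
  have e := TensorProduct.quotTensorEquivQuotSMul M 𝔭
  have e' := TensorProduct.quotTensorEquivQuotSMul M' 𝔭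
  have : Finite ((O ⧸ 𝔭) ⊗[O] M) := Finite.of_equiv _ e.symm.toEquiv
  have : Finite ((O ⧸ 𝔭) ⊗[O] M') := Finite.of_equiv _ e'.symm.toEquiv
  have h1 := Module.natCard_eq_pow_finrank (K := O ⧸ 𝔭) (V := (O ⧸ 𝔭) ⊗[O] M)
  have h2 := Module.natCard_eq_pow_finrank (K := O ⧸ 𝔭) (V := (O ⧸ 𝔭) ⊗[O] M')
  rw [Nat.card_congr e.toEquiv, h, ← Nat.card_congr e'.toEquiv, h2] at h1
  exact (Nat.pow_right_injective (Finite.one_lt_card) h1).symm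

/-- If `p` is invertible on a subgroup of finite index, then the module is the direct sum of its
finite `p`-primary torsion and a complement. -/
lemma exists_torsion_splitting {p : ℕ} (hp : p.Prime) (H : AddSubgroup M) [Finite (M ⧸ H)]
    (hH : BijectiveOn p H) : ∃ k : ℕ, k ≠ 0 ∧ Finite (Submodule.torsionBy O M ((p : O) ^ k)) ∧
      (∀ m : M, ∃ t : M, p ^ k • t = 0 ∧ ∃ b, m = t + p ^ k • b) ∧
      ∀ b : M, p ^ k • p ^ k • b = 0 → p ^ k • b = 0 := by
  obtain ⟨k, n, hk0, hn, hk⟩ := exists_eq_pow_mul_index hp H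
  have hmem : ∀ x, x ∈ Submodule.torsionBy O M ((p : O) ^ k) ↔ p ^ k • x = 0 := by
    intro x
    rw [Submodule.mem_torsionBy_iff, ← Nat.cast_pow, Nat.cast_smul_eq_nsmul]
  refine ⟨k, hk0, ?_, ?_, ?_⟩
  · refine Finite.of_injective (fun t => (QuotientAddGroup.mk t.1 : M ⧸ H)) ?_
    intro x y hxy
    have h1 := QuotientAddGroup.eq.mp hxy
    have h2 : p ^ k • (-x.1 + y.1) = 0 := by
      rw [smul_add, smul_neg, (hmem _).mp x.2, (hmem _).mp y.2, neg_zero, add_zero]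
    have := hH.eq_zero_of_pow k h1 h2
    exact Subtype.ext (neg_add_eq_zero.mp this)
  · intro m
    -- Dividing by p^(2k) rather than p^k leaves the non-torsion part of n m visibly in p^k M.
    obtain ⟨c, -, hc⟩ := hH.exists_pow (k + k) (hk m)
    have ht : p ^ k • (n • m - p ^ k • c) = 0 := by
      rw [smul_sub, ← mul_nsmul, ← mul_nsmul, ← pow_add, hc, mul_comm, sub_self]
    obtain ⟨x, y, hxy⟩ := Nat.isCoprime_iff_coprime.mpr (hn.pow_right k)
    refine ⟨x • (n • m - p ^ k • c), by rw [smul_comm, ht, smul_zero], x • c + y • m, ?_⟩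
    calc m = (x * (n : ℤ) + y * (p ^ k : ℕ)) • m := by rw [hxy, one_smul]
      _ = x • (n • m) + p ^ k • (y • m) := by
        rw [add_smul, mul_smul, natCast_zsmul, mul_comm y, mul_smul, natCast_zsmul]
      _ = _ := by rw [smul_sub, smul_add, smul_comm x (p ^ k) c]; abel
  · intro b hb
    refine eq_zero_of_coprime (hn.pow_right k) ?_ hb
    refine hH.eq_zero_of_pow k ?_ ?_
    · rw [← mul_nsmul]
      exact hk b
    · rw [smul_comm, hb, smul_zero]

/-- Put T = M[p^k] and D = p^k M, so M is the direct sum of T and D. Since D ⊆ pM ⊆ 𝔭M, the quotient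
of M/pM by 𝔭 is T/𝔭T, of order |T[𝔭]| = |M[𝔭]|. As M[𝔭] is also the 𝔭-torsion of M[p], this is the
order of M[p]/𝔭M[p]; dimensions over the finite field O/𝔭 follow by counting. -/
lemma finrank_tensor_quotient_eq [IsDedekindDomain O] {p : ℕ} (hp : p.Prime)
    (hp0 : (p : O) ≠ 0) (H : AddSubgroup M) [Finite (M ⧸ H)] (hH : BijectiveOn p H)
    (N : Submodule O M) (hN : ∀ m, m ∈ N ↔ ∃ r, m = p • r) (𝔭 : Ideal O) [𝔭.IsMaximal]
    [Finite (O ⧸ 𝔭)] (h𝔭 : (p : O) ∈ 𝔭) :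
    Module.finrank (O ⧸ 𝔭) ((O ⧸ 𝔭) ⊗[O] (M ⧸ N)) =
      Module.finrank (O ⧸ 𝔭) ((O ⧸ 𝔭) ⊗[O] Submodule.torsionBy O M (p : O)) := by
  obtain ⟨k, hk0, hfin, hsum, hdisj⟩ := exists_torsion_splitting (O := O) hp H hH
  set T := Submodule.torsionBy O M ((p : O) ^ k) with hT
  have hcast : ∀ x : M, (p : O) ^ k • x = p ^ k • x := fun x => by
    rw [← Nat.cast_pow, Nat.cast_smul_eq_nsmul]
  have hmem : ∀ x, x ∈ T ↔ p ^ k • x = 0 := fun x => by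
    rw [Submodule.mem_torsionBy_iff, hcast]
  set D : Submodule O M := (LinearMap.lsmul O M ((p : O) ^ k)).range with hD
  have hTD : (⊤ : Submodule O M) = T ⊔ D := by
    refine le_antisymm (fun m _ => ?_) le_top
    obtain ⟨t, ht, b, rfl⟩ := hsum m
    exact Submodule.add_mem_sup ((hmem t).mpr ht) ⟨b, hcast b⟩
  have hdisj' : ∀ x ∈ T, x ∈ D → x = 0 := by
    rintro _ hx ⟨b, rfl⟩
    rw [hmem] at hx
    simp only [LinearMap.lsmul_apply, hcast] at hx ⊢
    exact hdisj b hx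
  have hpT : Submodule.torsionBy O M (p : O) ≤ T := fun x hx => by
    rw [Submodule.mem_torsionBy_iff] at hx ⊢
    obtain ⟨j, rfl⟩ := Nat.exists_eq_succ_of_ne_zero hk0
    rw [pow_succ, mul_smul, hx, smul_zero]
  have hfin' : Finite (Submodule.torsionBy O M (p : O)) :=
    Finite.of_injective _ (Submodule.inclusion_injective hpT)
  have htor : Submodule.torsionBySet O M (𝔭 : Set O) ≤ Submodule.torsionBy O M (p : O) :=
    fun x hx => (Submodule.mem_torsionBySet_iff _ _).mp hx ⟨_, h𝔭⟩
  have hNle : N ≤ 𝔭 • ⊤ := fun x hx => by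
    obtain ⟨r, rfl⟩ := (hN x).mp hx
    rw [← Nat.cast_smul_eq_nsmul O]
    exact Submodule.smul_mem_smul h𝔭 trivial
  set g : T →ₗ[O] (M ⧸ N) ⧸ (𝔭 • ⊤ : Submodule O (M ⧸ N)) :=
    (Submodule.mkQ _).comp (N.mkQ.comp T.subtype) with hg
  have hzero : ∀ m : M, N.mkQ m ∈ (𝔭 • ⊤ : Submodule O (M ⧸ N)) ↔ m ∈ (𝔭 • ⊤ : Submodule O M) := by
    intro m
    rw [← N.range_mkQ, LinearMap.range_eq_map, ← Submodule.map_smul'', ← Submodule.mem_comap,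
      Submodule.comap_map_mkQ, sup_eq_right.mpr hNle]
  have hker : g.ker = 𝔭 • ⊤ := by
    ext t
    rw [LinearMap.mem_ker, Submodule.mem_smul_top_iff]
    have h1 : g t = 0 ↔ t.1 ∈ (𝔭 • ⊤ : Submodule O M) := by
      rw [← hzero, ← Submodule.Quotient.mk_eq_zero (𝔭 • ⊤ : Submodule O (M ⧸ N))]
      rfl
    rw [h1]
    refine ⟨fun h => ?_, fun h => Submodule.smul_mono le_rfl le_top h⟩
    rw [hTD, Submodule.smul_sup] at h
    obtain ⟨x, hx, y, hy, hxy⟩ := Submodule.mem_sup.mp h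
    have hyT : y ∈ T := by
      rw [← add_sub_cancel_left x y, hxy]
      exact sub_mem t.2 (Submodule.smul_le_right hx)
    rw [hdisj' y hyT (Submodule.smul_le_right hy), add_zero] at hxy
    rwa [← hxy]
  have hsurj : Function.Surjective g := by
    intro q
    obtain ⟨q, rfl⟩ := Submodule.mkQ_surjective _ q
    obtain ⟨m, rfl⟩ := N.mkQ_surjective q
    obtain ⟨t, ht, b, rfl⟩ := hsum m
    refine ⟨⟨t, (hmem t).mpr ht⟩, ?_⟩
    have hb : p ^ k • b ∈ N := by
      rw [hN]
      obtain ⟨j, rfl⟩ := Nat.exists_eq_succ_of_ne_zero hk0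
      exact ⟨p ^ j • b, by rw [pow_succ, mul_nsmul, smul_comm]⟩
    have hb' : N.mkQ (p ^ k • b) = 0 := (Submodule.Quotient.mk_eq_zero N).mpr hb
    rw [map_add, hb', add_zero]
    rfl
  have e := g.quotKerEquivOfSurjective hsurj
  have : Finite ((M ⧸ N) ⧸ (𝔭 • ⊤ : Submodule O (M ⧸ N))) := Finite.of_surjective g hsurj
  have : Finite (Submodule.torsionBy O M (p : O) ⧸
      (𝔭 • ⊤ : Submodule O (Submodule.torsionBy O M (p : O)))) :=
    Finite.of_surjective _ (Submodule.mkQ_surjective _)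
  refine finrank_tensor_eq_of_card 𝔭 ?_
  rw [← Nat.card_congr e.toEquiv, hker,
    card_quotient_smul_top 𝔭 (Ideal.pow_mem_of_mem 𝔭 h𝔭 k (Nat.pos_of_ne_zero hk0))
      (pow_ne_zero k hp0) (fun t => Subtype.ext (by simpa [hcast] using (hmem t.1).mp t.2)),
    card_quotient_smul_top 𝔭 h𝔭 hp0 (fun t => Subtype.ext t.2),
    card_torsionBySet_of_le (htor.trans hpT), card_torsionBySet_of_le htor]

end Rank

/-! ### Good models, and the decomposition E(L_w) = E(K_v) + kernel of reduction. -/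

section GoodModel

open WithZero WeierstrassCurve WeierstrassCurve.Affine

/-- The change of variables `C` transforms `W` into an integral equation with unit discriminant. -/
structure GoodModel {F : Type*} [Field F] (v : Valuation F ℤᵐ⁰) (W : WeierstrassCurve F)
    (C : VariableChange F) : Prop where
  integral : IntegralCoeffs v (C • W)
  unit : v (C • W).Δ = 1

lemma GoodModel.Δ_ne_zero {F : Type*} [Field F] {v : Valuation F ℤᵐ⁰} {W : WeierstrassCurve F}
    {C : VariableChange F} (h : GoodModel v W C) : W.Δ ≠ 0 := by
  intro h0
  have h1 := h.unit
  rw [variableChange_Δ, h0, mul_zero, map_zero] at h1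
  exact zero_ne_one h1

lemma GoodModel.variableChange_Δ_ne_zero {F : Type*} [Field F] {v : Valuation F ℤᵐ⁰}
    {W : WeierstrassCurve F} {C : VariableChange F} (h : GoodModel v W C) : (C • W).Δ ≠ 0 := by
  intro h0
  have h1 := h.unit
  rw [h0, map_zero] at h1
  exact zero_ne_one h1

lemma IntegralCoeffs.val_equation_lt_one_of_congr {F : Type*} [Field F] {v : Valuation F ℤᵐ⁰}
    {W : WeierstrassCurve F} (hW : IntegralCoeffs v W) {X Y x y : F}
    (h : W.toAffine.Equation X Y) (hX : v X ≤ 1) (hY : v Y ≤ 1) (hx : v x ≤ 1) (hy : v y ≤ 1)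
    (hXx : v (X - x) < 1) (hYy : v (Y - y) < 1) :
    v (y ^ 2 + W.a₁ * x * y + W.a₃ * y - (x ^ 3 + W.a₂ * x ^ 2 + W.a₄ * x + W.a₆)) < 1 := by
  obtain ⟨g1, g2, g3, g4, -⟩ := hW
  rw [equation_iff] at h
  rw [show y ^ 2 + W.a₁ * x * y + W.a₃ * y - (x ^ 3 + W.a₂ * x ^ 2 + W.a₄ * x + W.a₆) =
      (X - x) * (x ^ 2 + x * X + X ^ 2 + W.a₂ * (x + X) + W.a₄ - W.a₁ * Y) -
      (Y - y) * (y + Y + W.a₁ * x + W.a₃) by linear_combination h]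
  refine Valuation.map_sub_lt v (vlt_mul hXx ?_) (vlt_mul hYy ?_)
  · exact vle_sub (vle_add (vle_add (vle_add (vle_add (vle_pow 2 hx) (vle_mul hx hX))
      (vle_pow 2 hX)) (vle_mul g2 (vle_add hx hX))) g4) (vle_mul g1 hY)
  · exact vle_add (vle_add (vle_add hy hY) (vle_mul g1 hx)) g3

variable {K : Type u} [Field K] {E : WeierstrassCurve K}
  {F : Type u} [Field F] [Algebra K F] {v : Valuation F ℤᵐ⁰} {C : VariableChange F}

open Classical in
/-- The points of `E(F)` which reduce to the origin of a good model. -/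
def goodKernel (h : GoodModel v (E.baseChange F) C) : AddSubgroup (Points E F) :=
  show AddSubgroup (E.baseChange F).toAffine.Point from
    (kerReduction h.integral).comap (vcHom C h.Δ_ne_zero)

open Classical in
lemma finite_quotient_goodKernel (h : GoodModel v (E.baseChange F) C) {κ : Type*} [Finite κ]
    (r : F → κ) (hr : ∀ x y, v x ≤ 1 → v y ≤ 1 → r x = r y → v (x - y) < 1) :
    Finite (Points E F ⧸ goodKernel h) := by
  have := finite_quotient_kerReduction h.integral h.unit r hr
  have hi := AddSubgroup.index_comap_of_surjective (kerReduction h.integral)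
    (f := vcHom C h.Δ_ne_zero) (vcHom_surjective C h.Δ_ne_zero)
  have h0 : (goodKernel h).index ≠ 0 := by
    change ((kerReduction h.integral).comap (vcHom C h.Δ_ne_zero)).index ≠ 0
    rw [hi]
    exact AddSubgroup.index_ne_zero_of_finite
  have : (goodKernel h).FiniteIndex := ⟨h0⟩
  infer_instance

open Classical in
lemma bijectiveOn_goodKernel (h : GoodModel v (E.baseChange F) C) (hv : HasLimits v) {n p : ℕ}
    (hn : v (n : F) < 1) (hnp : Nat.Coprime p n) : BijectiveOn p (goodKernel h) := by
  obtain ⟨h1, h2⟩ := kerReduction_bijective hv h.integral h.variableChange_Δ_ne_zero hn hnp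
  constructor
  · intro P hP h0
    refine vcHom_injective C h.Δ_ne_zero ((h1 _ hP ?_).trans (map_zero _).symm)
    exact (map_nsmul (vcHom C h.Δ_ne_zero) p _).symm.trans
      ((congrArg (vcHom C h.Δ_ne_zero) h0).trans (map_zero _))
  · intro P hP
    obtain ⟨Q, hQ, hQP⟩ := h2 _ hP
    obtain ⟨Q, rfl⟩ := vcHom_surjective C h.Δ_ne_zero Q
    refine ⟨Q, hQ, vcHom_injective C h.Δ_ne_zero ?_⟩
    rw [← hQP]
    exact map_nsmul _ _ _

variable {M : Type u} [Field M] [Algebra K M] [Algebra F M] [IsScalarTower K F M]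
  {w : Valuation M ℤᵐ⁰}

variable (M) in
lemma variableChange_baseChange (E : WeierstrassCurve K) (C : VariableChange F) :
    C.map (algebraMap F M) • E.baseChange M = (C • E.baseChange F).map (algebraMap F M) := by
  rw [← map_variableChange]
  congr 1
  change E.map _ = (E.map _).map _
  rw [WeierstrassCurve.map_map, ← IsScalarTower.algebraMap_eq]

lemma GoodModel.baseChange (h : GoodModel v (E.baseChange F) C)
    (hle : ∀ x, v x ≤ 1 → w (algebraMap F M x) ≤ 1)
    (hone : ∀ x, v x = 1 → w (algebraMap F M x) = 1) :
    GoodModel w (E.baseChange M) (C.map (algebraMap F M)) := by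
  obtain ⟨⟨h1, h2, h3, h4, h6⟩, hΔ⟩ := h
  constructor
  · rw [variableChange_baseChange]
    exact ⟨hle _ h1, hle _ h2, hle _ h3, hle _ h4, hle _ h6⟩
  · rw [variableChange_baseChange, WeierstrassCurve.map_Δ]
    exact hone _ hΔ

-- The coordinates of b on the good model are congruent to integers of the smaller field by `hres`.
-- Hensel's lemma turns these into a point over that field with the same reduction as b, so the
-- difference reduces to the origin.
open Classical in
lemma exists_sub_incl_mem_goodKernel (h : GoodModel v (E.baseChange F) C)
    (h' : GoodModel w (E.baseChange M) (C.map (algebraMap F M))) (hv : HasLimits v)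
    (hlt : ∀ x, v x < 1 → w (algebraMap F M x) < 1)
    (hle : ∀ x, v x ≤ 1 → w (algebraMap F M x) ≤ 1)
    (hres : ∀ x : M, w x ≤ 1 → ∃ y : F, v y ≤ 1 ∧ w (x - algebraMap F M y) < 1)
    (b : Points E M) : ∃ a : Points E F, b - incl E F M a ∈ goodKernel h' := by
  by_cases hb : b ∈ goodKernel h'
  · exact ⟨0, by rwa [map_zero, sub_zero]⟩
  -- Otherwise x would be a unit, and its inverse would stay integral in M. This brings the
  -- approximate equation from M down to F.
  have hge : ∀ x, w (algebraMap F M x) < 1 → v x ≤ 1 → v x < 1 := by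
    intro x hx hx'
    refine lt_of_le_of_ne hx' fun h1 => ?_
    have h2 := hle x⁻¹ (by rw [map_inv₀, h1, inv_one])
    rw [map_inv₀, map_inv₀] at h2
    have h0 : x ≠ 0 := by
      rintro rfl
      simp at h1
    exact absurd hx (not_lt.mpr ((inv_le_one₀ (zero_lt_iff.mpr (by simpa using h0))).mp h2))
  rcases b with _ | ⟨x, y, hxy⟩
  · exact absurd (zero_mem _) hb
  obtain ⟨X, Y, hXY, hbXY⟩ : ∃ X Y hXY,
      vcHom (C.map (algebraMap F M)) h'.Δ_ne_zero (.some x y hxy) = .some X Y hXY := ⟨_, _, vcHom_some (C.map (algebraMap F M)) h'.Δ_ne_zero hxy⟩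
  change ¬ InKer w (vcHom (C.map (algebraMap F M)) h'.Δ_ne_zero (.some x y hxy)) at hb
  rw [hbXY] at hb
  have hX : w X ≤ 1 := not_lt.mp hb
  have hY : w Y ≤ 1 := val_y_le_one h'.integral hXY.1 hX
  obtain ⟨X₀, hX₀, hXX₀⟩ := hres X hX
  obtain ⟨Y₀, hY₀, hYY₀⟩ := hres Y hY
  obtain ⟨i1, i2, i3, i4, i6⟩ := h.integral
  have hval : v (Y₀ ^ 2 + (C • E.baseChange F).a₁ * X₀ * Y₀ + (C • E.baseChange F).a₃ * Y₀ -
      (X₀ ^ 3 + (C • E.baseChange F).a₂ * X₀ ^ 2 + (C • E.baseChange F).a₄ * X₀ +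
        (C • E.baseChange F).a₆)) < 1 := by
    refine hge _ ?_ (vle_sub (vle_add (vle_add (vle_pow 2 hY₀) (vle_mul (vle_mul i1 hX₀) hY₀))
      (vle_mul i3 hY₀)) (vle_add (vle_add (vle_add (vle_pow 3 hX₀) (vle_mul i2 (vle_pow 2 hX₀)))
      (vle_mul i4 hX₀)) i6))
    have hc := h'.integral.val_equation_lt_one_of_congr hXY.1 hX hY (hle X₀ hX₀) (hle Y₀ hY₀)
      hXX₀ hYY₀
    rw [variableChange_baseChange] at hc
    simpa only [map_sub, map_add, map_mul, map_pow, WeierstrassCurve.map_a₁,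
      WeierstrassCurve.map_a₂, WeierstrassCurve.map_a₃, WeierstrassCurve.map_a₄,
      WeierstrassCurve.map_a₆] using hc
  obtain ⟨X₁, Y₁, hXY₁, hX₁, hY₁⟩ := exists_equation_of_congr hv h.integral h.unit hX₀ hY₀ hval
  obtain ⟨x₁, y₁, hxy₁, -, hx₁, hy₁, -⟩ := vcHom_exists_some C h.Δ_ne_zero hXY₁
  set a : Points E F := Point.some x₁ y₁ hxy₁ with ha
  refine ⟨a, ?_⟩
  obtain ⟨hxy', hincl⟩ : ∃ h₁', incl E F M a =
      Point.some (algebraMap F M x₁) (algebraMap F M y₁) h₁' := ⟨_, rfl⟩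
  obtain ⟨hXY', hbXY'⟩ := vcHom_some (C.map (algebraMap F M)) h'.Δ_ne_zero hxy'
  have hxX : vcX (C.map (algebraMap F M)) (algebraMap F M x₁) = algebraMap F M X₁ := by
    rw [← hx₁]
    simp [vcX, VariableChange.map]
  have hyY : vcY (C.map (algebraMap F M)) (algebraMap F M x₁) (algebraMap F M y₁) =
      algebraMap F M Y₁ := by
    rw [← hy₁]
    simp [vcY, VariableChange.map]
  have hd : ∀ {Z : M} {Z₀ Z₁ : F}, w (Z - algebraMap F M Z₀) < 1 → v (Z₁ - Z₀) < 1 →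
      w (Z - algebraMap F M Z₁) < 1 := by
    intro Z Z₀ Z₁ h1 h2
    have h3 := Valuation.map_sub_lt w h1 (hlt _ h2)
    rwa [map_sub (algebraMap F M), sub_sub_sub_cancel_right] at h3
  have hX₁' : v X₁ ≤ 1 := by
    have := vle_add hX₁.le hX₀
    rwa [sub_add_cancel] at this
  have hfin := inKer_sub_of_congr h'.integral h'.unit hXY hXY' hX (by rw [hxX]; exact hle _ hX₁')
    (by rw [hxX]; exact hd hXX₀ hX₁) (by rw [hyY]; exact hd hYY₀ hY₁)
  rw [← hbXY, ← hbXY', ← map_sub] at hfin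
  rw [hincl]
  exact hfin

end GoodModel

/-! ### The norm on points of the base field. -/

section Norm

variable {K : Type u} [Field K] (E : WeierstrassCurve K)
  (F M : Type u) [Field F] [Field M] [Algebra K F] [Algebra K M] [Algebra F M] [IsScalarTower K F M]

open Classical in
lemma incl_injective : Function.Injective (incl E F M) :=
  WeierstrassCurve.Affine.Point.map_injective (IsScalarTower.toAlgHom K F M)

/-- On `E(F)` the norm is multiplication by the degree. -/
lemma norm_incl (L' : IntermediateField F M) [FiniteDimensional F M] [IsGalois F M]
    (a : Points E F) : norm E F M L' (incl E F M a) = Module.finrank L' M • incl E F M a := by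
  classical
  have hfix : ∀ σ : M ≃ₐ[L'] M, Points.map E
      ((σ.restrictScalars F).restrictScalars K : M ≃ₐ[K] M).toAlgHom (incl E F M a) =
        incl E F M a := by
    intro σ
    have hc : ((σ.restrictScalars F).restrictScalars K : M ≃ₐ[K] M).toAlgHom.comp
        (IsScalarTower.toAlgHom K F M) = IsScalarTower.toAlgHom K F M := by
      ext x
      exact (σ.restrictScalars F).commutes x
    refine (WeierstrassCurve.Affine.Point.map_map _ _ _).trans ?_
    rw [hc]
    rfl
  rw [norm, finsum_eq_sum_of_fintype, AddMonoidHom.finsetSum_apply, Finset.sum_congr rfl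
    (fun σ _ => hfix σ), Finset.sum_const, Finset.card_univ, ← Nat.card_eq_fintype_card,
    IsGalois.card_aut_eq_finrank]

end Norm

/-! ### Local input: the good model and the residue characteristic. -/

section LocalField

variable {K L : Type u} [Field K] [NumberField K] [Field L] [NumberField L] [Algebra K L]
  (v : HeightOneSpectrum (𝓞 K)) (w : HeightOneSpectrum (𝓞 L)) [w.asIdeal.LiesOver v.asIdeal]

open WithZero in
lemma HasGoodReductionAt.exists_goodModel {v : HeightOneSpectrum (𝓞 K)} {E : WeierstrassCurve K}
    (h : HasGoodReductionAt v E) :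
    ∃ C, GoodModel (Valued.v : Valuation (v.adicCompletion K) ℤᵐ⁰)
      (E.baseChange (v.adicCompletion K)) C := by
  obtain ⟨C, hC⟩ := h
  refine ⟨C, ?_⟩
  have hle : ∀ r : v.adicCompletionIntegers K,
      Valued.v (algebraMap (v.adicCompletionIntegers K) (v.adicCompletion K) r) ≤ 1 := fun r => r.2
  constructor
  · constructor
    · rw [← WeierstrassCurve.integralModel_a₁_eq (v.adicCompletionIntegers K)]
      exact hle _
    · rw [← WeierstrassCurve.integralModel_a₂_eq (v.adicCompletionIntegers K)]
      exact hle _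
    · rw [← WeierstrassCurve.integralModel_a₃_eq (v.adicCompletionIntegers K)]
      exact hle _
    · rw [← WeierstrassCurve.integralModel_a₄_eq (v.adicCompletionIntegers K)]
      exact hle _
    · rw [← WeierstrassCurve.integralModel_a₆_eq (v.adicCompletionIntegers K)]
      exact hle _
  · have h1 := hC.goodReduction
    rw [← WeierstrassCurve.integralModel_Δ_eq (v.adicCompletionIntegers K)] at h1 ⊢
    set d := ((C • E.baseChange (v.adicCompletion K)).integralModel
      (v.adicCompletionIntegers K)).Δ
    have hu : IsUnit d := by
      by_contra hd
      exact h1.not_lt ((HeightOneSpectrum.valuation_lt_one_iff_mem _ _).mpr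
        ((IsLocalRing.mem_maximalIdeal d).mpr hd))
    obtain ⟨e, he⟩ := hu.exists_right_inv
    have h2 := congrArg (fun x => Valued.v (algebraMap (v.adicCompletionIntegers K)
      (v.adicCompletion K) x)) he
    simp only [map_mul, map_one] at h2
    refine le_antisymm (hle d) ?_
    rw [← h2]
    exact mul_le_of_le_one_right' (hle e)

lemma natCast_ringChar_lt_one :
    Valued.v ((ringChar (𝓞 K ⧸ v.asIdeal) : ℕ) : v.adicCompletion K) < 1 := by
  have h := (valued_algebraMap_lt_one_iff (K := K) v (ringChar (𝓞 K ⧸ v.asIdeal) : ℕ)).mpr (by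
    rw [← Ideal.Quotient.eq_zero_iff_mem, map_natCast]
    exact ringChar.Nat.cast_ringChar)
  rwa [map_natCast] at h

instance : Finite (𝓞 K ⧸ v.asIdeal) := Ideal.finiteQuotientOfFreeOfNeBot _ v.ne_bot

/-- This is where v ∤ p enters: it supplies the relation between p and the residue characteristic
that makes p invertible on both kernels. -/
lemma coprime_ringChar {p : ℕ} (hp : p.Prime) (hvp : (p : 𝓞 K) ∉ v.asIdeal) :
    Nat.Coprime p (ringChar (𝓞 K ⧸ v.asIdeal)) := by
  rw [Nat.coprime_primes hp (CharP.char_is_prime (𝓞 K ⧸ v.asIdeal) _)]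
  rintro rfl
  apply hvp
  rw [← Ideal.Quotient.eq_zero_iff_mem, map_natCast]
  exact ringChar.Nat.cast_ringChar

end LocalField

end EllCM

end

theorem mainTheorem4
    {𝕂 : Type*} [Field 𝕂] [NumberField 𝕂] [Algebra.IsQuadraticExtension ℚ 𝕂]
    [NumberField.IsTotallyComplex 𝕂]
    {K L : Type u} [Field K] [NumberField K] [Field L] [NumberField L] [Algebra K L]
    (p : ℕ) (hp : p.Prime) (hp2 : p ≠ 2)
    [IsGalois K L] [IsCyclic (L ≃ₐ[K] L)] (hL : ∃ n : ℕ, Module.finrank K L = p ^ n)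
    (E : WeierstrassCurve K) [E.IsElliptic]
    (ι : EllCM.CMEmbedding E (𝓞 𝕂))
    (𝔭₁ 𝔭₂ : Ideal (𝓞 𝕂)) [𝔭₁.IsPrime] [𝔭₂.IsPrime] (h𝔭 : 𝔭₁ ≠ 𝔭₂)
    (hsplit : Ideal.span {(p : 𝓞 𝕂)} = 𝔭₁ * 𝔭₂)
    (v : HeightOneSpectrum (𝓞 K)) (w : HeightOneSpectrum (𝓞 L)) [w.asIdeal.LiesOver v.asIdeal]
    (hvp : (p : 𝓞 K) ∉ v.asIdeal)
    (hgood : EllCM.HasGoodReductionAt v E)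
    (hnontriv : (⊥ : IntermediateField (v.adicCompletion K) (w.adicCompletion L)) ≠ ⊤)
    (hram : EllCM.IsTotallyRamified v w)
    (L' : IntermediateField (v.adicCompletion K) (w.adicCompletion L))
    (hL' : EllCM.IsIndexP (v.adicCompletion K) (w.adicCompletion L) p L') :
    EllCM.localConstant (v.adicCompletion K) (w.adicCompletion L) ι 𝔭₁ 𝔭₂ L' =
      EllCM.modTwo (EllCM.rankPair 𝔭₁ 𝔭₂
        (Submodule.torsionBy (𝓞 𝕂) (ι.Module (v.adicCompletion K)) (p : 𝓞 𝕂))) := by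
  obtain ⟨C, hC⟩ := hgood.exists_goodModel
  have hC' := hC.baseChange (M := w.adicCompletion L)
    (fun x => (EllCM.valued_algebraMap_le_lt v w x).1)
    (fun x => EllCM.valued_algebraMap_eq_one v w)
  have hn := EllCM.natCast_ringChar_lt_one v
  have hn' := (EllCM.valued_algebraMap_le_lt v w _).2 hn
  rw [map_natCast] at hn'
  have hcop := EllCM.coprime_ringChar v hp hvp
  obtain ⟨r, hr⟩ := EllCM.exists_residue_map K v
  obtain ⟨r', hr'⟩ := EllCM.exists_residue_map L w
  have := EllCM.isGalois_adicCompletion v w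
  have hA := EllCM.bijectiveOn_goodKernel hC (EllCM.hasLimits_adicCompletion v) hn hcop
  have hB := EllCM.bijectiveOn_goodKernel hC' (EllCM.hasLimits_adicCompletion w) hn' hcop
  have hfA := EllCM.finite_quotient_goodKernel hC r hr
  have hfB := EllCM.finite_quotient_goodKernel hC' r' hr'
  have hsum := EllCM.exists_sub_incl_mem_goodKernel hC hC' (EllCM.hasLimits_adicCompletion v)
    (fun x => (EllCM.valued_algebraMap_le_lt v w x).2)
    (fun x => (EllCM.valued_algebraMap_le_lt v w x).1) hram
  -- Nontriviality of L_w/K_v selects the case [L_w : L'] = p, so the norm is multiplication by p on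
  -- E(K_v), and `normSubmodule` consists exactly of the multiples of p.
  have hnorm := EllCM.exists_eq_map_iff_exists_nsmul hp
    (EllCM.incl E (v.adicCompletion K) (w.adicCompletion L))
    (EllCM.incl_injective E _ _) (EllCM.norm E _ _ L')
    (fun a => by rw [EllCM.norm_incl, hL'.1 hnontriv]) _ _ hA hB hsum
  have hp0 : (p : 𝓞 𝕂) ≠ 0 := Nat.cast_ne_zero.mpr hp.ne_zero
  have hmem : (p : 𝓞 𝕂) ∈ 𝔭₁ * 𝔭₂ := hsplit ▸ Ideal.mem_span_singleton_self _
  -- The ranks agree as natural numbers at every prime containing p; reduction modulo 2 is applied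
  -- only afterwards.
  have hrank : ∀ 𝔭 : Ideal (𝓞 𝕂), 𝔭.IsPrime → (p : 𝓞 𝕂) ∈ 𝔭 →
      Module.finrank (𝓞 𝕂 ⧸ 𝔭) ((𝓞 𝕂 ⧸ 𝔭) ⊗[𝓞 𝕂] (ι.Module (v.adicCompletion K) ⧸
        EllCM.normSubmodule (v.adicCompletion K) (w.adicCompletion L) ι L')) =
      Module.finrank (𝓞 𝕂 ⧸ 𝔭) ((𝓞 𝕂 ⧸ 𝔭) ⊗[𝓞 𝕂]
        Submodule.torsionBy (𝓞 𝕂) (ι.Module (v.adicCompletion K)) (p : 𝓞 𝕂)) := by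
    intro 𝔭 h𝔭 hp𝔭
    have hbot : 𝔭 ≠ ⊥ := fun h => hp0 (by simpa [h] using hp𝔭)
    have := h𝔭.isMaximal hbot
    have := Ideal.finiteQuotientOfFreeOfNeBot 𝔭 hbot
    let H : AddSubgroup (ι.Module (v.adicCompletion K)) := EllCM.goodKernel hC
    have hH : Finite (ι.Module (v.adicCompletion K) ⧸ H) := hfA
    exact EllCM.finrank_tensor_quotient_eq hp hp0 H hA
      (EllCM.normSubmodule (v.adicCompletion K) (w.adicCompletion L) ι L') hnorm 𝔭 hp𝔭
  refine congrArg EllCM.modTwo (Prod.ext ?_ ?_)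
  · exact hrank 𝔭₁ inferInstance (Ideal.mul_le_left hmem)
  · exact hrank 𝔭₂ inferInstance (Ideal.mul_le_right hmem)
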